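/- **Setting.** Composition is written in diagrammatic order. Let $(\mathcal W,\otimes,I)$ be a symmetric monoidal category with symmetry $\sigma$, and let $i:\mathcal U\hookrightarrow\mathcal W$ be a full strict monoidal subcategory: a full subcategory that contains $I$ and is closed under $\otimes$, and in which the associators and unitors are identities. The *partial slice functor* $N=\mathcal U/(-):\mathcal W\to\mathbf{Cat}$ sends $A$ to the comma category of pairs $(U\in\mathcal U,\ f:U\to A)$, whose arrows $(U,f)\to(V,g)$ are the arrows $\varphi:U\to V$ with $\varphi\circ g=f$ (first $\varphi$, then $g$), and acts on arrows by post-composition. It is a (lax) monoidal functor by means of $*\mapsto \mathrm{id}_I$ and $\tilde N_{A_1,A_2}:N A_1\times NA_2\to N(A_1\otimes A_2)$, $(f_1,f_2)\mapsto f_1\otimes f_2$, $(\varphi,\psi)\mapsto\varphi\otimes\psi$. For a $\mathcal W$-category $\mathcal C$, the change of base $N_*\mathcal C$ is the 2-category with the objects of $\mathcal C$ as 0-cells and $N(\mathcal C(A,B))$ as hom-categories. Its 1-cells $A\to B$ are thus the pairs $(U,\ f:U\to\mathcal C(A,B))$, and composition of 1-cells takes the tensor product of the parameter objects. Write $\mathcal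 C_0$ for the underlying category of $\mathcal C$, regarded as a 2-category with only identity 2-cells, and $\iota:\mathcal C_0\to N_*\mathcal C$ for the assignment that is the identity on objects and sends $f:I\to\mathcal C(A,B)$ to $(I,f)$. A *monoidal $\mathcal W$-category* $(\mathcal C,\boxtimes,J,a,l,r)$ is a $\mathcal W$-category with a $\mathcal W$-functor $\boxtimes:\mathcal C\otimes\mathcal C\to\mathcal C$, an object $J$, and $\mathcal W$-natural isomorphisms $a_{A,B,D}:(A\boxtimes B)\boxtimes D\to A\boxtimes(B\boxtimes D)$, $l_A:J\boxtimes A\to A$, $r_A:A\boxtimes J\to A$ satisfying the pentagon and triangle identities in $\mathcal C_0$. It is *symmetric* if it is equipped with a $\mathcal W$-natural $s_{A,B}:A\boxtimes B\to B\boxtimes A$ with $s_{A,B}\circ s_{B,A}=\mathrm{id}$ satisfying the hexagon identity and the compatibility with the unitors. A *nearly strict monoidal 2-category* is a 2-category $\mathbb C$ with a pseudofunctor $\boxtimes:\mathbb C\times\mathbb C\to\mathbb C$ (with invertible *tensorators* $\vartheta_{f_1,f_2,g_1,g_2}:(f_1\boxtimes f_2)\circ(g_1\boxtimes g_2)\Rightarrow(f_1\circ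 g_1)\boxtimes(f_2\circ g_2)$), an object $J$, and invertible 1-cells $a,l,r$ as above that are strictly 2-natural and satisfy the pentagon and triangle identities as equalities of 1-cells. A *nearly strict symmetric monoidal 2-category* carries in addition a strong 2-natural transformation with 1-cell components $s_{A,B}:A\boxtimes B\to B\boxtimes A$ (natural up to coherent invertible 2-cells) which satisfy $s_{A,B}\circ s_{B,A}=\mathrm{id}$, the hexagon identity and the compatibility with the unitors as equalities of 1-cells. **Proposition 3.11.** Let $\mathcal W$ and $\mathcal U$ be as above and let $\mathcal C$ be a $\mathcal W$-category. 1. $\iota$ is a (strict) 2-functor $\mathcal C_0\to N_*\mathcal C$. 2. Let $(\mathcal C,\boxtimes,J,a,l,r)$ be a monoidal $\mathcal W$-category. Then $N_*\mathcal C$ is a nearly strict monoidal 2-category with the following structure. The product $\boxtimes^N$ is $\boxtimes$ on 0-cells and is given on hom-categories by $$N\mathcal C(A_1,B_1)\times N\mathcal C(A_2,B_2)\xrightarrow{\ \tilde N\ }N\big(\mathcal C(A_1,B_1)\otimes\mathcal C(A_2,B_2)\big)\xrightarrow{\ N\boxtimes\ }N\mathcal C(A_1\boxtimes A_2,B_1\boxtimes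 B_2).$$ The unit is $J$. The unit constraint $\mathrm{id}\Rightarrow\mathrm{id}\boxtimes^N\mathrm{id}$ is the canonical $I=I\otimes I$. For 1-cells $f_i$ with parameter object $U_i$ and $g_i$ with parameter object $V_i$, the tensorator $\vartheta_{f_1,f_2,g_1,g_2}$ is the middle-four interchange symmetry $$(U_1\otimes U_2)\otimes(V_1\otimes V_2)\to(U_1\otimes V_1)\otimes(U_2\otimes V_2)$$ of $\mathcal W$. The coherence 1-cells are $(I,a)$, $(I,l)$, $(I,r)$, and these are strictly 2-natural. Moreover $\iota$ strictly preserves the monoidal structure: $\iota(A\boxtimes B)=\iota A\boxtimes^N\iota B$, $\iota(f\boxtimes g)=\iota f\boxtimes^N\iota g$, $\iota J=J$, $\iota$ sends $a,l,r$ to the coherence 1-cells of $N_*\mathcal C$, and the unit constraints and tensorators of $N_*\mathcal C$ at objects and 1-cells in the image of $\iota$ are identities. 3. Let $(\mathcal C,\boxtimes,J,a,l,r,s)$ be a symmetric monoidal $\mathcal W$-category. Then $N_*\mathcal C$, with the structure in 2, is a nearly strict symmetric monoidal 2-category with symmetry 1-cells $(I,s_{A,B})$. For 1-cells $f_i=(U_i,f_i):A_i\to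 B_i$, the 2-cell $$s_{A_1,A_2}\circ(f_2\boxtimes^N f_1)\Rightarrow(f_1\boxtimes^N f_2)\circ s_{B_1,B_2}$$ up to which the symmetry is natural is $\sigma_{U_2,U_1}:U_2\otimes U_1\to U_1\otimes U_2$ (using $I\otimes(U_2\otimes U_1)=U_2\otimes U_1$ and $U_1\otimes U_2=(U_1\otimes U_2)\otimes I$). Moreover $\iota$ also sends $s$ to the symmetry 1-cells of $N_*\mathcal C$, and the naturality 2-cells of the symmetry at 1-cells in the image of $\iota$ are identities. -/

import Mathlib

open CategoryTheory MonoidalCategory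

universe w v u u₁ u₂

namespace PartialSlice

/-! ### Interchange identities in a symmetric monoidal category -/

section Interchange

variable {W : Type u} [Category.{v} W] [MonoidalCategory W]

theorem unit_comp_associator {Z₁ Z₂ Z₃ : W} (e₁ : 𝟙_ W ⟶ Z₁) (e₂ : 𝟙_ W ⟶ Z₂)
    (e₃ : 𝟙_ W ⟶ Z₃) :
    ((λ_ (𝟙_ W)).inv ≫ (((λ_ (𝟙_ W)).inv ≫ (e₁ ⊗ₘ e₂)) ⊗ₘ e₃)) ≫ (α_ Z₁ Z₂ Z₃).hom =
      (λ_ (𝟙_ W)).inv ≫ (e₁ ⊗ₘ ((λ_ (𝟙_ W)).inv ≫ (e₂ ⊗ₘ e₃))) := by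
  have h : ((λ_ (𝟙_ W)).inv ≫ (e₁ ⊗ₘ e₂)) ⊗ₘ e₃ =
    (λ_ (𝟙_ W)).inv ▷ _ ≫ ((e₁ ⊗ₘ e₂) ⊗ₘ e₃) := by
    rw [← tensorHom_id, tensorHom_comp_tensorHom, Category.id_comp]
  have h' : e₁ ⊗ₘ ((λ_ (𝟙_ W)).inv ≫ (e₂ ⊗ₘ e₃)) =
    _ ◁ (λ_ (𝟙_ W)).inv ≫ (e₁ ⊗ₘ (e₂ ⊗ₘ e₃)) := by
    rw [← id_tensorHom, tensorHom_comp_tensorHom, Category.id_comp]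
  rw [h, h', Category.assoc, Category.assoc, associator_naturality]
  monoidal

theorem eId_comp_eId {C : Type u₁} [EnrichedCategory W C] (J : C) :
   (λ_ (𝟙_ W)).inv ≫ (eId W J ⊗ₘ eId W J) ≫ eComp W J J J = eId W J := by
  rw [MonoidalCategory.tensorHom_def', Category.assoc, ← leftUnitor_inv_naturality_assoc, e_id_comp, Category.comp_id]

theorem unit_lift {Z₁ Z₂ Z : W} (e₁ : 𝟙_ W ⟶ Z₁) (e₂ : 𝟙_ W ⟶ Z₂) (t : Z₁ ⊗ Z₂ ⟶ Z)
    (e : 𝟙_ W ⟶ Z) (h : ((λ_ (𝟙_ W)).inv ≫ (e₁ ⊗ₘ e₂)) ≫ t = e) :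
    (λ_ (𝟙_ W)).inv ≫ ((𝟙 (𝟙_ W) ≫ e₁) ⊗ₘ (𝟙 (𝟙_ W) ≫ e₂)) ≫ t = 𝟙 (𝟙_ W) ≫ e := by
  simpa using h

variable [SymmetricCategory W]

theorem tensorμ_comp_associator {X₁ X₂ X₃ Y₁ Y₂ Y₃ Z₁ Z₂ Z₃ : W} (c₁ : X₁ ⊗ Y₁ ⟶ Z₁) (c₂ : X₂ ⊗ Y₂ ⟶ Z₂)
    (c₃ : X₃ ⊗ Y₃ ⟶ Z₃) :
    (tensorμ (X₁ ⊗ X₂) X₃ (Y₁ ⊗ Y₂) Y₃ ≫ ((tensorμ X₁ X₂ Y₁ Y₂ ≫ (c₁ ⊗ₘ c₂)) ⊗ₘ c₃)) ≫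
        (α_ Z₁ Z₂ Z₃).hom =
      ((α_ X₁ X₂ X₃).hom ⊗ₘ (α_ Y₁ Y₂ Y₃).hom) ≫ tensorμ X₁ (X₂ ⊗ X₃) Y₁ (Y₂ ⊗ Y₃) ≫
        (c₁ ⊗ₘ (tensorμ X₂ X₃ Y₂ Y₃ ≫ (c₂ ⊗ₘ c₃))) := by
  have h : (tensorμ X₁ X₂ Y₁ Y₂ ≫ (c₁ ⊗ₘ c₂)) ⊗ₘ c₃ =
    tensorμ X₁ X₂ Y₁ Y₂ ▷ (X₃ ⊗ Y₃) ≫ ((c₁ ⊗ₘ c₂) ⊗ₘ c₃) := by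
    rw [← tensorHom_id, tensorHom_comp_tensorHom, Category.id_comp]
  have h' : c₁ ⊗ₘ (tensorμ X₂ X₃ Y₂ Y₃ ≫ (c₂ ⊗ₘ c₃)) =
    (X₁ ⊗ Y₁) ◁ tensorμ X₂ X₃ Y₂ Y₃ ≫ (c₁ ⊗ₘ (c₂ ⊗ₘ c₃)) := by
    rw [← id_tensorHom, tensorHom_comp_tensorHom, Category.id_comp]
  rw [h, h', Category.assoc, Category.assoc, associator_naturality, associator_monoidal_assoc]

theorem tensorμ_comp_braiding {X₁ X₂ Y₁ Y₂ Z₁ Z₂ : W} (c₁ : X₁ ⊗ Y₁ ⟶ Z₁) (c₂ : X₂ ⊗ Y₂ ⟶ Z₂) :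
    (tensorμ X₁ X₂ Y₁ Y₂ ≫ (c₁ ⊗ₘ c₂)) ≫ (β_ Z₁ Z₂).hom =
      ((β_ X₁ X₂).hom ⊗ₘ (β_ Y₁ Y₂).hom) ≫ tensorμ X₂ X₁ Y₂ Y₁ ≫ (c₂ ⊗ₘ c₁) := by
  rw [Category.assoc, BraidedCategory.braiding_naturality]
  simp only [← Category.assoc]
  congr 1
  simp [tensorμ, SymmetricCategory.braiding_swap_eq_inv_braiding Y₁ X₂, MonoidalCategory.tensorHom_def]

theorem unit_comp_braiding {Z₁ Z₂ : W} (e₁ : 𝟙_ W ⟶ Z₁) (e₂ : 𝟙_ W ⟶ Z₂) :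
    ((λ_ (𝟙_ W)).inv ≫ (e₁ ⊗ₘ e₂)) ≫ (β_ Z₁ Z₂).hom = (λ_ (𝟙_ W)).inv ≫ (e₂ ⊗ₘ e₁) := by
  rw [Category.assoc, BraidedCategory.braiding_naturality]
  simp [unitors_inv_equal]

theorem comp_insertLeft {J X Y Z : W} (e : 𝟙_ W ⟶ J) (m : J ⊗ J ⟶ J) (c : X ⊗ Y ⟶ Z)
    (h : (λ_ (𝟙_ W)).inv ≫ (e ⊗ₘ e) ≫ m = e) :
    c ≫ (λ_ Z).inv ≫ (e ▷ Z) =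
      (((λ_ X).inv ≫ (e ▷ X)) ⊗ₘ ((λ_ Y).inv ≫ (e ▷ Y))) ≫ tensorμ J X J Y ≫ (m ⊗ₘ c) := by
  rw [Iso.inv_comp_eq] at h
  rw [← tensorHom_comp_tensorHom, ← tensorHom_id, ← tensorHom_id, ← tensorHom_id, Category.assoc,
    tensorμ_natural_assoc, tensorHom_comp_tensorHom, h, id_tensorHom_id, Category.id_comp]
  have := leftUnitor_monoidal X Y
  have h2 : ((λ_ X).inv ⊗ₘ (λ_ Y).inv) ≫ tensorμ (𝟙_ W) X (𝟙_ W) Y =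
    (λ_ (X ⊗ Y)).inv ≫ (λ_ (𝟙_ W)).inv ▷ (X ⊗ Y) := by
    rw [← cancel_mono (((λ_ (𝟙_ W)).hom ▷ (X ⊗ Y)) ≫ (λ_ (X ⊗ Y)).hom), Category.assoc, ← this]
    simp [tensorHom_comp_tensorHom]
  rw [reassoc_of% h2]
  rw [leftUnitor_inv_naturality_assoc, ← id_tensorHom, tensorHom_comp_tensorHom, Category.id_comp,
    Category.comp_id, ← tensorHom_id, tensorHom_comp_tensorHom, Iso.inv_hom_id_assoc,
    Category.id_comp]

theorem comp_insertRight {J X Y Z : W} (e : 𝟙_ W ⟶ J) (m : J ⊗ J ⟶ J) (c : X ⊗ Y ⟶ Z)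
    (h : (λ_ (𝟙_ W)).inv ≫ (e ⊗ₘ e) ≫ m = e) :
    c ≫ (ρ_ Z).inv ≫ (Z ◁ e) =
      (((ρ_ X).inv ≫ (X ◁ e)) ⊗ₘ ((ρ_ Y).inv ≫ (Y ◁ e))) ≫ tensorμ X J Y J ≫ (c ⊗ₘ m) := by
  rw [Iso.inv_comp_eq] at h
  rw [← tensorHom_comp_tensorHom, ← id_tensorHom, ← id_tensorHom, ← id_tensorHom, Category.assoc,
    tensorμ_natural_assoc, tensorHom_comp_tensorHom, h, id_tensorHom_id, Category.id_comp]
  have := rightUnitor_monoidal X Y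
  have h2 : ((ρ_ X).inv ⊗ₘ (ρ_ Y).inv) ≫ tensorμ X (𝟙_ W) Y (𝟙_ W) =
    (ρ_ (X ⊗ Y)).inv ≫ (X ⊗ Y) ◁ (λ_ (𝟙_ W)).inv := by
    rw [← cancel_mono (((X ⊗ Y) ◁ (λ_ (𝟙_ W)).hom) ≫ (ρ_ (X ⊗ Y)).hom), Category.assoc, ← this]
    simp [tensorHom_comp_tensorHom]
  rw [reassoc_of% h2]
  rw [rightUnitor_inv_naturality_assoc, ← tensorHom_id, tensorHom_comp_tensorHom, Category.id_comp,
    Category.comp_id, ← id_tensorHom, tensorHom_comp_tensorHom, Iso.inv_hom_id_assoc,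
    Category.id_comp]

theorem comp_lift {U₁ U₂ V₁ V₂ X₁ X₂ Y₁ Y₂ Z₁ Z₂ X Y Z : W} (f₁ : U₁ ⟶ X₁) (f₂ : U₂ ⟶ X₂)
    (g₁ : V₁ ⟶ Y₁) (g₂ : V₂ ⟶ Y₂) (c₁ : X₁ ⊗ Y₁ ⟶ Z₁) (c₂ : X₂ ⊗ Y₂ ⟶ Z₂) (t₁ : X₁ ⊗ X₂ ⟶ X)
    (t₂ : Y₁ ⊗ Y₂ ⟶ Y) (c : X ⊗ Y ⟶ Z) (t : Z₁ ⊗ Z₂ ⟶ Z)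
    (h : (tensorμ X₁ X₂ Y₁ Y₂ ≫ (c₁ ⊗ₘ c₂)) ≫ t = (t₁ ⊗ₘ t₂) ≫ c) :
    tensorμ U₁ U₂ V₁ V₂ ≫ (((f₁ ⊗ₘ g₁) ≫ c₁) ⊗ₘ ((f₂ ⊗ₘ g₂) ≫ c₂)) ≫ t =
      (((f₁ ⊗ₘ f₂) ≫ t₁) ⊗ₘ ((g₁ ⊗ₘ g₂) ≫ t₂)) ≫ c := by
  rw [← tensorHom_comp_tensorHom, ← tensorHom_comp_tensorHom, Category.assoc, Category.assoc,
    ← h, Category.assoc, tensorμ_natural_assoc]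

theorem braiding_lift {U₁ U₂ X₁ X₂ X Y S T Z : W} (f₁ : U₁ ⟶ X₁) (f₂ : U₂ ⟶ X₂)
    (t : X₁ ⊗ X₂ ⟶ X) (t' : X₂ ⊗ X₁ ⟶ Y) (s : 𝟙_ W ⟶ S) (s' : 𝟙_ W ⟶ T) (c : S ⊗ Y ⟶ Z)
    (c' : X ⊗ T ⟶ Z)
    (h : (λ_ (X₁ ⊗ X₂)).inv ≫ (s ⊗ₘ ((β_ X₁ X₂).hom ≫ t')) ≫ c =
      (ρ_ (X₁ ⊗ X₂)).inv ≫ (t ⊗ₘ s') ≫ c') :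
    ((λ_ (U₂ ⊗ U₁)).hom ≫ (β_ U₂ U₁).hom ≫ (ρ_ (U₁ ⊗ U₂)).inv) ≫
        ((((f₁ ⊗ₘ f₂) ≫ t) ⊗ₘ s') ≫ c') =
      (s ⊗ₘ ((f₂ ⊗ₘ f₁) ≫ t')) ≫ c := by
  have h₁ : ((f₁ ⊗ₘ f₂) ≫ t) ⊗ₘ s' = ((f₁ ⊗ₘ f₂) ▷ 𝟙_ W) ≫ (t ⊗ₘ s') := by
    rw [← tensorHom_id, tensorHom_comp_tensorHom, Category.id_comp]
  have h₂ : s ⊗ₘ ((f₂ ⊗ₘ f₁) ≫ t') =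
      (𝟙_ W ◁ ((β_ U₂ U₁).hom ≫ (f₁ ⊗ₘ f₂))) ≫ (s ⊗ₘ ((β_ X₁ X₂).hom ≫ t')) := by
    rw [← id_tensorHom, tensorHom_comp_tensorHom, Category.id_comp, Category.assoc,
      BraidedCategory.braiding_naturality_assoc, SymmetricCategory.symmetry_assoc]
  rw [h₁, h₂, Category.assoc, Category.assoc, Category.assoc, Category.assoc,
    ← rightUnitor_inv_naturality_assoc, ← h, ← Iso.eq_inv_comp,
    ← leftUnitor_inv_naturality_assoc, Category.assoc]

end Interchange

/-! ### Enriched categories: natural transformations, products, monoidal structures -/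

section Enriched

variable {W : Type u} [Category.{v} W] [MonoidalCategory W]

/-- A `W`-natural transformation between `W`-functors: a family of arrows
`app X : 𝟙_ W ⟶ D(F X, G X)` of `W` (that is, arrows of the underlying category of `D`) satisfying
the `W`-naturality hexagon.  (This is stronger than naturality for the underlying functors.) -/
structure VNatTrans {C : Type u₁} [EnrichedCategory W C] {D : Type u₂} [EnrichedCategory W D]
    (F G : EnrichedFunctor W C D) where
  /-- the components, as arrows of the underlying category -/
  app (X : C) : ForgetEnrichment.of W (F.obj X) ⟶ ForgetEnrichment.of W (G.obj X)
  naturality (X Y : C) :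
    (λ_ (X ⟶[W] Y)).inv ≫ (ForgetEnrichment.homTo W (app X) ⊗ₘ G.map X Y) ≫
        eComp W (F.obj X) (G.obj X) (G.obj Y) =
      (ρ_ (X ⟶[W] Y)).inv ≫ (F.map X Y ⊗ₘ ForgetEnrichment.homTo W (app Y)) ≫
        eComp W (F.obj X) (F.obj Y) (G.obj Y)

variable [SymmetricCategory W]

/-- The tensor product of two `W`-categories: pairs of objects, tensor products of hom-objects;
composition uses the middle-four interchange of `W`. -/
instance enrichedProd (C : Type u₁) [EnrichedCategory W C] (D : Type u₂) [EnrichedCategory W D] :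
    EnrichedCategory W (C × D) where
  Hom X Y := (X.1 ⟶[W] Y.1) ⊗ (X.2 ⟶[W] Y.2)
  id X := (λ_ (𝟙_ W)).inv ≫ (eId W X.1 ⊗ₘ eId W X.2)
  comp X Y Z := tensorμ _ _ _ _ ≫ (eComp W X.1 Y.1 Z.1 ⊗ₘ eComp W X.2 Y.2 Z.2)
  id_comp X Y := by
    rw [comp_whiskerRight, Category.assoc, tensorμ_natural_left_assoc, tensorHom_comp_tensorHom,
      Iso.inv_comp_eq, tensor_left_unitality, Category.comp_id,
      Iso.inv_comp_eq _ |>.1 (e_id_comp W X.1 Y.1), Iso.inv_comp_eq _ |>.1 (e_id_comp W X.2 Y.2),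
      Category.comp_id, Category.comp_id]
  comp_id X Y := by
    rw [MonoidalCategory.whiskerLeft_comp, Category.assoc, tensorμ_natural_right_assoc,
      tensorHom_comp_tensorHom, Iso.inv_comp_eq, tensor_right_unitality, Category.comp_id,
      Iso.inv_comp_eq _ |>.1 (e_comp_id W X.1 Y.1), Iso.inv_comp_eq _ |>.1 (e_comp_id W X.2 Y.2),
      Category.comp_id, Category.comp_id]
  assoc X Y Z T := by
    rw [comp_whiskerRight, Category.assoc, tensorμ_natural_left_assoc, tensorHom_comp_tensorHom,
      MonoidalCategory.whiskerLeft_comp, Category.assoc, tensorμ_natural_right_assoc,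
      tensorHom_comp_tensorHom, Iso.inv_comp_eq, ← e_assoc, ← e_assoc,
      ← tensorHom_comp_tensorHom (α_ _ _ _).inv, ← tensor_associativity_assoc,
      tensorHom_comp_tensorHom_assoc]
    simp

variable {C : Type u₁} [EnrichedCategory W C] {D : Type u₂} [EnrichedCategory W D]

theorem eComp_prod (X Y Z : C × D) : eComp W X Y Z =
    tensorμ _ _ _ _ ≫ (eComp W X.1 Y.1 Z.1 ⊗ₘ eComp W X.2 Y.2 Z.2) := rfl

theorem eId_prod (X : C × D) :
    eId W X = (λ_ (𝟙_ W)).inv ≫ (eId W X.1 ⊗ₘ eId W X.2) := rfl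

variable {C' : Type u₁} [EnrichedCategory W C'] {D' : Type u₂} [EnrichedCategory W D']

/-- The tensor product of two `W`-functors. -/
def prodFunctor (F : EnrichedFunctor W C C') (G : EnrichedFunctor W D D') :
    EnrichedFunctor W (C × D) (C' × D') where
  obj X := (F.obj X.1, G.obj X.2)
  map X Y := F.map X.1 Y.1 ⊗ₘ G.map X.2 Y.2
  map_id X := by simp [eId_prod, tensorHom_comp_tensorHom]
  map_comp X Y Z := by
    rw [eComp_prod, eComp_prod, Category.assoc, tensorHom_comp_tensorHom, F.map_comp, G.map_comp,
      ← tensorHom_comp_tensorHom, ← tensorμ_natural_assoc]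

variable (W C) in
/-- The associator `W`-functor `(C ⊗ C) ⊗ C ⟶ C ⊗ (C ⊗ C)`. -/
def prodAssoc : EnrichedFunctor W ((C × C) × C) (C × (C × C)) where
  obj X := (X.1.1, (X.1.2, X.2))
  map X Y := (α_ (X.1.1 ⟶[W] Y.1.1) (X.1.2 ⟶[W] Y.1.2) (X.2 ⟶[W] Y.2)).hom
  map_id _ := unit_comp_associator _ _ _
  map_comp _ _ _ := tensorμ_comp_associator _ _ _

variable (W C) in
/-- The symmetry `W`-functor `C ⊗ C ⟶ C ⊗ C`. -/
def prodSwap : EnrichedFunctor W (C × C) (C × C) where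
  obj X := (X.2, X.1)
  map X Y := (β_ (X.1 ⟶[W] Y.1) (X.2 ⟶[W] Y.2)).hom
  map_id _ := unit_comp_braiding _ _
  map_comp _ _ _ := tensorμ_comp_braiding _ _

variable (W) in
/-- The `W`-functor `C ⟶ C ⊗ C`, `X ↦ (J, X)`. -/
def insertLeft (J : C) : EnrichedFunctor W C (C × C) where
  obj X := (J, X)
  map X Y := (λ_ (X ⟶[W] Y)).inv ≫ (eId W J ▷ (X ⟶[W] Y))
  map_id X := by
    rw [eId_prod, MonoidalCategory.tensorHom_def', leftUnitor_inv_naturality_assoc]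
  map_comp _ _ _ := comp_insertLeft _ _ _ (eId_comp_eId J)

variable (W) in
/-- The `W`-functor `C ⟶ C ⊗ C`, `X ↦ (X, J)`. -/
def insertRight (J : C) : EnrichedFunctor W C (C × C) where
  obj X := (X, J)
  map X Y := (ρ_ (X ⟶[W] Y)).inv ≫ ((X ⟶[W] Y) ◁ eId W J)
  map_id X := by
    rw [eId_prod, MonoidalCategory.tensorHom_def, rightUnitor_inv_naturality_assoc,
      unitors_inv_equal]
  map_comp _ _ _ := comp_insertRight _ _ _ (eId_comp_eId J)

/-- The action of a `W`-functor `T : C ⊗ C ⟶ C` on arrows of the underlying category: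
`f ⊠₀ g`. -/
def tensorHom₀ (T : EnrichedFunctor W (C × C) C) {A₁ B₁ A₂ B₂ : C}
    (f : ForgetEnrichment.of W A₁ ⟶ ForgetEnrichment.of W B₁)
    (g : ForgetEnrichment.of W A₂ ⟶ ForgetEnrichment.of W B₂) :
    ForgetEnrichment.of W (T.obj (A₁, A₂)) ⟶ ForgetEnrichment.of W (T.obj (B₁, B₂)) :=
  ForgetEnrichment.homOf W ((λ_ (𝟙_ W)).inv ≫
    (ForgetEnrichment.homTo W f ⊗ₘ ForgetEnrichment.homTo W g) ≫ T.map (A₁, A₂) (B₁, B₂))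

variable (W) in
/-- A monoidal `W`-category structure on the `W`-category `C`: a `W`-functor `⊠ : C ⊗ C ⟶ C`, a
unit object, and `W`-natural isomorphisms `a`, `l`, `r` (invertible in the underlying category)
satisfying the pentagon and triangle identities in the underlying category. -/
structure MonoidalVCategory (C : Type u₁) [EnrichedCategory W C] where
  tensor : EnrichedFunctor W (C × C) C
  unit : C
  associator : VNatTrans
    ((prodFunctor tensor (EnrichedFunctor.id W C)).comp W tensor)
    ((prodAssoc W C).comp W ((prodFunctor (EnrichedFunctor.id W C) tensor).comp W tensor))
  leftUnitor : VNatTrans ((insertLeft W unit).comp W tensor) (EnrichedFunctor.id W C)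
  rightUnitor : VNatTrans ((insertRight W unit).comp W tensor) (EnrichedFunctor.id W C)
  associator_isIso (X : (C × C) × C) : IsIso (associator.app X)
  leftUnitor_isIso (X : C) : IsIso (leftUnitor.app X)
  rightUnitor_isIso (X : C) : IsIso (rightUnitor.app X)
  pentagon (X Y Z T : C) :
    tensorHom₀ tensor (associator.app ((X, Y), Z)) (𝟙 (ForgetEnrichment.of W T)) ≫
        associator.app ((X, tensor.obj (Y, Z)), T) ≫
          tensorHom₀ tensor (𝟙 (ForgetEnrichment.of W X)) (associator.app ((Y, Z), T)) =
      associator.app ((tensor.obj (X, Y), Z), T) ≫ associator.app ((X, Y), tensor.obj (Z, T))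
  triangle (X Y : C) :
    associator.app ((X, unit), Y) ≫
        tensorHom₀ tensor (𝟙 (ForgetEnrichment.of W X)) (leftUnitor.app Y) =
      tensorHom₀ tensor (rightUnitor.app X) (𝟙 (ForgetEnrichment.of W Y))

variable (W) in
/-- A symmetric monoidal `W`-category structure on `C`: in addition a `W`-natural symmetry
`s : ⊠ ⟶ ⊠ ∘ swap` satisfying the axioms of a symmetric monoidal category in the underlying
category. -/
structure SymmetricMonoidalVCategory (C : Type u₁) [EnrichedCategory W C] extends
    MonoidalVCategory W C where
  braiding : VNatTrans tensor ((prodSwap W C).comp W tensor)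
  braiding_braiding (X Y : C) :
    braiding.app (X, Y) ≫ braiding.app (Y, X) = 𝟙 (ForgetEnrichment.of W (tensor.obj (X, Y)))
  hexagon (X Y Z : C) :
    associator.app ((X, Y), Z) ≫ braiding.app (X, tensor.obj (Y, Z)) ≫
        associator.app ((Y, Z), X) =
      tensorHom₀ tensor (braiding.app (X, Y)) (𝟙 (ForgetEnrichment.of W Z)) ≫
        associator.app ((Y, X), Z) ≫
          tensorHom₀ tensor (𝟙 (ForgetEnrichment.of W Y)) (braiding.app (X, Z))
  braiding_leftUnitor (X : C) :
    braiding.app (X, unit) ≫ leftUnitor.app X = rightUnitor.app X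

end Enriched

/-! ### The partial slice functor as a monoidal functor to `Cat` -/

section PartialSliceFunctor

/-- A monoidal category is strict if its associators and unitors are identities. -/
class IsStrictMonoidal (V : Type u) [Category.{v} V] [MonoidalCategory V] : Prop where
  associator_eq (X Y Z : V) : ∃ h : (X ⊗ Y) ⊗ Z = X ⊗ (Y ⊗ Z), α_ X Y Z = eqToIso h
  leftUnitor_eq (X : V) : ∃ h : 𝟙_ V ⊗ X = X, λ_ X = eqToIso h
  rightUnitor_eq (X : V) : ∃ h : X ⊗ 𝟙_ V = X, ρ_ X = eqToIso h

theorem id_eq {V : Type u} [Category.{v} V] (X : V) : ∃ h, 𝟙 X = eqToHom h := ⟨rfl, rfl⟩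

section
variable {V : Type u} [Category.{v} V] [MonoidalCategory V] [IsStrictMonoidal V]

theorem associator_hom_eq (X Y Z : V) : ∃ h, (α_ X Y Z).hom = eqToHom h := by
  obtain ⟨h, e⟩ := IsStrictMonoidal.associator_eq X Y Z
  exact ⟨h, by rw [e]; rfl⟩

theorem leftUnitor_inv_eq (X : V) : ∃ h, (λ_ X).inv = eqToHom h := by
  obtain ⟨h, e⟩ := IsStrictMonoidal.leftUnitor_eq X
  exact ⟨h.symm, by rw [e]; rfl⟩

theorem rightUnitor_inv_eq (X : V) : ∃ h, (ρ_ X).inv = eqToHom h := by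
  obtain ⟨h, e⟩ := IsStrictMonoidal.rightUnitor_eq X
  exact ⟨h.symm, by rw [e]; rfl⟩

end

variable {W : Type u} [Category.{v} W] (P : ObjectProperty W)

/-- The partial slice functor `U/(-) : W ⥤ Cat` of the full subcategory `i : U ⥤ W` of objects
satisfying `P`: it sends `A` to the comma category `(i ↓ A)` of pairs `(U, f : i U ⟶ A)` and acts
on arrows by post-composition. -/
abbrev partialSlice : W ⥤ Cat.{v, max u v} :=
  CostructuredArrow.functor P.ι

variable {P} in
theorem heq_homs {A : W} {X Y X' Y' : CostructuredArrow P.ι A} (φ : X ⟶ Y) (ψ : X' ⟶ Y')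
    (hX : X = X') (hY : Y = Y')
    {a : X.left ⟶ X'.left} {b : Y.left ⟶ Y'.left}
    (ha : ∃ h, a = eqToHom h) (hb : ∃ h, b = eqToHom h)
    (h : φ.left ≫ b = a ≫ ψ.left) : φ ≍ ψ := by
  subst hX hY
  obtain ⟨_, rfl⟩ := ha
  obtain ⟨_, rfl⟩ := hb
  rw [eqToHom_refl, eqToHom_refl, Category.comp_id, Category.id_comp] at h
  exact heq_of_eq (CostructuredArrow.hom_ext _ _ h)

variable {P} in
theorem obj_eq {A : W} {U V : P.FullSubcategory} {f : U.obj ⟶ A} {g : V.obj ⟶ A}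
    {a : U ⟶ V} (ha : ∃ h, a = eqToHom h) (h : a.hom ≫ g = f) :
    CostructuredArrow.mk (S := P.ι) (Y := U) f = CostructuredArrow.mk (S := P.ι) (Y := V) g := by
  obtain ⟨e, rfl⟩ := ha
  exact CostructuredArrow.obj_ext _ _ e h

variable [MonoidalCategory W] [P.IsMonoidal]

/-- The unit comparison functor `1 ⥤ U/I`, which picks the object `𝟙 I : I ⟶ I`. -/
def partialSliceUnit : 𝟙_ Cat.{v, max u v} ⟶ (partialSlice P).obj (𝟙_ W) :=
  (Cat.fromChosenTerminalEquiv.symm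
    (CostructuredArrow.mk (S := P.ι) (Y := 𝟙_ P.FullSubcategory) (𝟙 (𝟙_ W)))).toCatHom

/-- The comparison functor `U/A₁ × U/A₂ ⥤ U/(A₁ ⊗ A₂)`, `(f₁, f₂) ↦ f₁ ⊗ f₂`. -/
def partialSliceTensor (A₁ A₂ : W) :
    (partialSlice P).obj A₁ ⊗ (partialSlice P).obj A₂ ⟶ (partialSlice P).obj (A₁ ⊗ A₂) :=
  Functor.toCatHom (C := CostructuredArrow P.ι A₁ × CostructuredArrow P.ι A₂)
    (D := CostructuredArrow P.ι (A₁ ⊗ A₂))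
  { obj X := CostructuredArrow.mk (S := P.ι) (Y := X.1.left ⊗ X.2.left) (X.1.hom ⊗ₘ X.2.hom)
    map {X Y} φ := CostructuredArrow.homMk (φ.1.left ⊗ₘ φ.2.left) (by
      have h₁ : φ.1.left.hom ≫ Y.1.hom = X.1.hom := CostructuredArrow.w φ.1
      have h₂ : φ.2.left.hom ≫ Y.2.hom = X.2.hom := CostructuredArrow.w φ.2
      exact (tensorHom_comp_tensorHom ..).trans (by rw [h₁, h₂]; rfl))
    map_id X := CostructuredArrow.hom_ext _ _ (id_tensorHom_id ..)
    map_comp φ ψ := CostructuredArrow.hom_ext _ _ (tensorHom_comp_tensorHom ..).symm }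

instance partialSliceLaxMonoidal [IsStrictMonoidal P.FullSubcategory] :
    (partialSlice P).LaxMonoidal where
  ε := partialSliceUnit P
  μ := partialSliceTensor P
  μ_natural_left {A B} f A' := by
    have h (X : CostructuredArrow P.ι A × CostructuredArrow P.ι A') :
        CostructuredArrow.mk (S := P.ι) (Y := X.1.left ⊗ X.2.left) ((X.1.hom ≫ f) ⊗ₘ X.2.hom) =
          CostructuredArrow.mk (S := P.ι) (Y := X.1.left ⊗ X.2.left)
            ((X.1.hom ⊗ₘ X.2.hom) ≫ f ▷ A') := by
      rw [← tensorHom_id, tensorHom_comp_tensorHom, Category.comp_id]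
    apply Cat.ext
    refine Functor.hext (fun X => h X) (fun X Y φ => ?_)
    exact heq_homs _ _ (h X) (h Y) (id_eq _) (id_eq _)
      ((Category.comp_id _).trans (Category.id_comp _).symm)
  μ_natural_right {A B} A' f := by
    have h (X : CostructuredArrow P.ι A' × CostructuredArrow P.ι A) :
        CostructuredArrow.mk (S := P.ι) (Y := X.1.left ⊗ X.2.left) (X.1.hom ⊗ₘ (X.2.hom ≫ f)) =
          CostructuredArrow.mk (S := P.ι) (Y := X.1.left ⊗ X.2.left)
            ((X.1.hom ⊗ₘ X.2.hom) ≫ A' ◁ f) := by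
      rw [← id_tensorHom, tensorHom_comp_tensorHom, Category.comp_id]
    apply Cat.ext
    refine Functor.hext (fun X => h X) (fun X Y φ => ?_)
    exact heq_homs _ _ (h X) (h Y) (id_eq _) (id_eq _)
      ((Category.comp_id _).trans (Category.id_comp _).symm)
  associativity A₁ A₂ A₃ := by
    have h (X : (CostructuredArrow P.ι A₁ × CostructuredArrow P.ι A₂) ×
        CostructuredArrow P.ι A₃) :
        CostructuredArrow.mk (S := P.ι) (Y := (X.1.1.left ⊗ X.1.2.left) ⊗ X.2.left)
            (((X.1.1.hom ⊗ₘ X.1.2.hom) ⊗ₘ X.2.hom) ≫ (α_ A₁ A₂ A₃).hom) =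
          CostructuredArrow.mk (S := P.ι) (Y := X.1.1.left ⊗ (X.1.2.left ⊗ X.2.left))
            (X.1.1.hom ⊗ₘ (X.1.2.hom ⊗ₘ X.2.hom)) :=
      obj_eq (associator_hom_eq _ _ _) (associator_naturality _ _ _).symm
    apply Cat.ext
    refine Functor.hext (fun X => h X) (fun X Y φ => ?_)
    exact heq_homs _ _ (h X) (h Y) (associator_hom_eq _ _ _) (associator_hom_eq _ _ _)
      (associator_naturality _ _ _)
  left_unitality A := by
    have h (X : 𝟙_ Cat.{v, max u v} × CostructuredArrow P.ι A) :
        X.2 = CostructuredArrow.mk (S := P.ι) (Y := 𝟙_ _ ⊗ X.2.left)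
            ((𝟙 (𝟙_ W) ⊗ₘ X.2.hom) ≫ (λ_ A).hom) := by
      refine obj_eq (leftUnitor_inv_eq _) ?_
      have : (λ_ X.2.left.obj).inv ≫ (𝟙 (𝟙_ W) ⊗ₘ X.2.hom) ≫ (λ_ A).hom = X.2.hom := by
        rw [id_tensorHom, leftUnitor_naturality, Iso.inv_hom_id_assoc]
      exact this
    apply Cat.ext
    refine Functor.hext (fun X => h X) (fun X Y φ => ?_)
    refine heq_homs _ _ (h X) (h Y) (leftUnitor_inv_eq _) (leftUnitor_inv_eq _) ?_
    exact (leftUnitor_inv_naturality _).trans (by rw [← id_tensorHom]; rfl)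
  right_unitality A := by
    have h (X : CostructuredArrow P.ι A × 𝟙_ Cat.{v, max u v}) :
        X.1 = CostructuredArrow.mk (S := P.ι) (Y := X.1.left ⊗ 𝟙_ _)
            ((X.1.hom ⊗ₘ 𝟙 (𝟙_ W)) ≫ (ρ_ A).hom) := by
      refine obj_eq (rightUnitor_inv_eq _) ?_
      have : (ρ_ X.1.left.obj).inv ≫ (X.1.hom ⊗ₘ 𝟙 (𝟙_ W)) ≫ (ρ_ A).hom = X.1.hom := by
        rw [tensorHom_id, rightUnitor_naturality, Iso.inv_hom_id_assoc]
      exact this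
    apply Cat.ext
    refine Functor.hext (fun X => h X) (fun X Y φ => ?_)
    refine heq_homs _ _ (h X) (h Y) (rightUnitor_inv_eq _) (rightUnitor_inv_eq _) ?_
    exact (rightUnitor_inv_naturality _).trans (by rw [← tensorHom_id]; rfl)

end PartialSliceFunctor

/-! ### Nearly strict (symmetric) monoidal 2-categories -/

section NearlyStrict
open Bicategory

section
variable {B B' C C' : Type u} [Bicategory.{w, v} B] [Bicategory.{w, v} B'] [Bicategory.{w, v} C]
  [Bicategory.{w, v} C']

/-- The product of two pseudofunctors. -/
def prodPseudofunctor (F : B ⥤ᵖ B') (G : C ⥤ᵖ C') : (B × C) ⥤ᵖ (B' × C') where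
  obj X := (F.obj X.1, G.obj X.2)
  map f := (F.map f.1, G.map f.2)
  map₂ η := (F.map₂ η.1, G.map₂ η.2)
  map₂_id _ := Prod.ext (F.map₂_id _) (G.map₂_id _)
  map₂_comp _ _ := Prod.ext (F.map₂_comp _ _) (G.map₂_comp _ _)
  mapId X := Iso.prod (F.mapId X.1) (G.mapId X.2)
  mapComp f g := Iso.prod (F.mapComp f.1 g.1) (G.mapComp f.2 g.2)
  map₂_whisker_left _ _ _ _ := Prod.ext (F.map₂_whisker_left _ _) (G.map₂_whisker_left _ _)
  map₂_whisker_right _ _ := Prod.ext (F.map₂_whisker_right _ _) (G.map₂_whisker_right _ _)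
  map₂_associator _ _ _ := Prod.ext (F.map₂_associator _ _ _) (G.map₂_associator _ _ _)
  map₂_left_unitor _ := Prod.ext (F.map₂_left_unitor _) (G.map₂_left_unitor _)
  map₂_right_unitor _ := Prod.ext (F.map₂_right_unitor _) (G.map₂_right_unitor _)

variable (B) in
/-- The associativity 2-functor `(B × B) × B ⟶ B × (B × B)`. -/
def prodAssocPseudofunctor : StrictPseudofunctor ((B × B) × B) (B × (B × B)) := .mk'
  { obj X := (X.1.1, (X.1.2, X.2))
    map f := Prod.mkHom f.1.1 (Prod.mkHom f.1.2 f.2)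
    map₂ η := Prod.mkHom η.1.1 (Prod.mkHom η.1.2 η.2) }

/-- A strong transformation is a strict 2-natural transformation if its naturality 2-cells are
identities. -/
def IsStrictTrans {F G : B ⥤ᵖ C} (η : F.StrongTrans G) : Prop :=
  ∀ {a b : B} (f : a ⟶ b), ∃ h : F.map f ≫ η.app b = η.app a ≫ G.map f,
    η.naturality f = eqToIso h

/-- A 1-cell is invertible if it has a strict two-sided inverse. -/
def IsInvertible {a b : B} (f : a ⟶ b) : Prop :=
  ∃ g : b ⟶ a, f ≫ g = 𝟙 a ∧ g ≫ f = 𝟙 b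

end

/-- The raw data (without axioms) of a nearly strict monoidal 2-category: the monoidal product on
0-, 1- and 2-cells, the unit object, the unit constraint 2-cells and the tensorators
`ϑ : (f₁ ⊠ f₂) ≫ (g₁ ⊠ g₂) ⟶ (f₁ ≫ g₁) ⊠ (f₂ ≫ g₂)` of the monoidal product, and the coherence
1-cells. -/
structure NearlyStrictMonoidalData (B : Type u) [Bicategory.{w, v} B] where
  tensor : PrelaxFunctorStruct (B × B) B
  unit : B
  tensorUnitor (X : B × B) : 𝟙 (tensor.obj X) ⟶ tensor.map (𝟙 X)
  tensorator {X Y Z : B × B} (f : X ⟶ Y) (g : Y ⟶ Z) :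
    tensor.map f ≫ tensor.map g ⟶ tensor.map (f ≫ g)
  associator (X Y Z : B) :
    tensor.obj (tensor.obj (X, Y), Z) ⟶ tensor.obj (X, tensor.obj (Y, Z))
  leftUnitor (X : B) : tensor.obj (unit, X) ⟶ X
  rightUnitor (X : B) : tensor.obj (X, unit) ⟶ X

namespace NearlyStrictMonoidalData

variable {B : Type u} [Bicategory.{w, v} B] (D : NearlyStrictMonoidalData B)

/-- The pentagon identity for the associator 1-cells. -/
def Pentagon : Prop := ∀ X Y Z T : B,
  D.tensor.map (Prod.mkHom (D.associator X Y Z) (𝟙 T)) ≫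
      D.associator X (D.tensor.obj (Y, Z)) T ≫
        D.tensor.map (Prod.mkHom (𝟙 X) (D.associator Y Z T)) =
    D.associator (D.tensor.obj (X, Y)) Z T ≫ D.associator X Y (D.tensor.obj (Z, T))

/-- The triangle identity for the associator and unitor 1-cells. -/
def Triangle : Prop := ∀ X Y : B,
  D.associator X D.unit Y ≫ D.tensor.map (Prod.mkHom (𝟙 X) (D.leftUnitor Y)) =
    D.tensor.map (Prod.mkHom (D.rightUnitor X) (𝟙 Y))

end NearlyStrictMonoidalData

/-- The structure underlying a nearly strict monoidal 2-category, before imposing the pentagon and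
triangle identities: a 2-category (strict bicategory) `B`, a pseudofunctor `⊠ : B × B ⟶ B`, a unit
object, and invertible 1-cells `a`, `l`, `r` which form strict 2-natural transformations. -/
structure NearlyStrictMonoidalCore (B : Type u) [Bicategory.{w, v} B] [Strict B] where
  tensor : (B × B) ⥤ᵖ B
  unit : B
  associator : Pseudofunctor.StrongTrans
    ((prodPseudofunctor tensor (Pseudofunctor.id B)).comp tensor)
    ((prodAssocPseudofunctor B).toPseudofunctor.comp
      ((prodPseudofunctor (Pseudofunctor.id B) tensor).comp tensor))
  leftUnitor : Pseudofunctor.StrongTrans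
    ((Bicategory.Prod.sectR unit B).toPseudofunctor.comp tensor) (Pseudofunctor.id B)
  rightUnitor : Pseudofunctor.StrongTrans
    ((Bicategory.Prod.sectL B unit).toPseudofunctor.comp tensor) (Pseudofunctor.id B)
  associator_strict : IsStrictTrans associator
  leftUnitor_strict : IsStrictTrans leftUnitor
  rightUnitor_strict : IsStrictTrans rightUnitor
  associator_invertible (X : (B × B) × B) : IsInvertible (associator.app X)
  leftUnitor_invertible (X : B) : IsInvertible (leftUnitor.app X)
  rightUnitor_invertible (X : B) : IsInvertible (rightUnitor.app X)

/-- The raw data of a nearly strict monoidal 2-category. -/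
def NearlyStrictMonoidalCore.data {B : Type u} [Bicategory.{w, v} B] [Strict B]
    (M : NearlyStrictMonoidalCore B) : NearlyStrictMonoidalData B where
  tensor := M.tensor.toPrelaxFunctorStruct
  unit := M.unit
  tensorUnitor X := (M.tensor.mapId X).inv
  tensorator f g := (M.tensor.mapComp f g).inv
  associator X Y Z := M.associator.app ((X, Y), Z)
  leftUnitor X := M.leftUnitor.app X
  rightUnitor X := M.rightUnitor.app X

/-- A nearly strict monoidal 2-category structure on the 2-category `B`. -/
structure NearlyStrictMonoidal (B : Type u) [Bicategory.{w, v} B] [Strict B] extends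
    NearlyStrictMonoidalCore B where
  pentagon : toNearlyStrictMonoidalCore.data.Pentagon
  triangle : toNearlyStrictMonoidalCore.data.Triangle

/-- The raw data of a nearly strict symmetric monoidal 2-category: in addition the symmetry 1-cells
`s` and the 2-cells `s_{X₁,X₂} ≫ (f₂ ⊠ f₁) ⟶ (f₁ ⊠ f₂) ≫ s_{Y₁,Y₂}` for `fᵢ : Xᵢ ⟶ Yᵢ` up to
which they are natural. -/
structure NearlyStrictSymmetricMonoidalData (B : Type u) [Bicategory.{w, v} B] extends
    NearlyStrictMonoidalData B where
  braiding (X Y : B) : tensor.obj (X, Y) ⟶ tensor.obj (Y, X)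
  braidingCell {X Y : B × B} (f : X ⟶ Y) :
    braiding X.1 X.2 ≫ tensor.map (Prod.mkHom f.2 f.1) ⟶ tensor.map f ≫ braiding Y.1 Y.2

namespace NearlyStrictSymmetricMonoidalData

variable {B : Type u} [Bicategory.{w, v} B] (D : NearlyStrictSymmetricMonoidalData B)

/-- The symmetry 1-cells are mutually inverse. -/
def Involutive : Prop := ∀ X Y : B, D.braiding X Y ≫ D.braiding Y X = 𝟙 (D.tensor.obj (X, Y))

/-- The hexagon identity for the symmetry 1-cells. -/
def Hexagon : Prop := ∀ X Y Z : B,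
  D.associator X Y Z ≫ D.braiding X (D.tensor.obj (Y, Z)) ≫ D.associator Y Z X =
    D.tensor.map (Prod.mkHom (D.braiding X Y) (𝟙 Z)) ≫ D.associator Y X Z ≫
      D.tensor.map (Prod.mkHom (𝟙 Y) (D.braiding X Z))

/-- The compatibility of the symmetry 1-cells with the unitors. -/
def UnitTriangle : Prop := ∀ X : B,
  D.braiding X D.unit ≫ D.leftUnitor X = D.rightUnitor X

end NearlyStrictSymmetricMonoidalData

/-- The structure underlying a nearly strict symmetric monoidal 2-category, before imposing the
symmetry axioms: a nearly strict monoidal 2-category with a strong transformation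
`s : ⊠ ⟶ ⊠ ∘ swap`. -/
structure NearlyStrictSymmetricMonoidalCore (B : Type u) [Bicategory.{w, v} B] [Strict B] extends
    NearlyStrictMonoidal B where
  braiding : Pseudofunctor.StrongTrans tensor
    ((Bicategory.Prod.swap B B).toPseudofunctor.comp tensor)

/-- The raw data of a nearly strict symmetric monoidal 2-category. -/
def NearlyStrictSymmetricMonoidalCore.symmetricData {B : Type u} [Bicategory.{w, v} B] [Strict B]
    (M : NearlyStrictSymmetricMonoidalCore B) : NearlyStrictSymmetricMonoidalData B where
  toNearlyStrictMonoidalData := M.data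
  braiding X Y := M.braiding.app (X, Y)
  braidingCell f := (M.braiding.naturality f).inv

/-- A nearly strict symmetric monoidal 2-category structure on the 2-category `B`. -/
structure NearlyStrictSymmetricMonoidal (B : Type u) [Bicategory.{w, v} B] [Strict B] extends
    NearlyStrictSymmetricMonoidalCore B where
  involutive : toNearlyStrictSymmetricMonoidalCore.symmetricData.Involutive
  hexagon : toNearlyStrictSymmetricMonoidalCore.symmetricData.Hexagon
  unitTriangle : toNearlyStrictSymmetricMonoidalCore.symmetricData.UnitTriangle

end NearlyStrict

/-! ### The change of base along the partial slice functor and its structure -/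

section ChangeOfBase

variable {W : Type u} [Category.{v} W] [MonoidalCategory W]
  (P : ObjectProperty W) [P.IsMonoidal] [IsStrictMonoidal P.FullSubcategory]
  (C : Type u₁) [EnrichedCategory W C]

/-- The 2-category `U/(-)_* C`: the `Cat`-enriched category obtained from the `W`-category `C` by
change of base along the monoidal functor `U/(-)`, regarded as a strict bicategory.  Its 0-cells
are the objects of `C`, its 1-cells `A ⟶ B` are the pairs `(U, f : U ⟶ C(A, B))`, and its 2-cells
are reparametrizations. -/
abbrev SliceTwoCat : Type u₁ := CatEnriched (TransportEnrichment (partialSlice P) C)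

variable {P C}

/-- An object of `C` as a 0-cell of `U/(-)_* C`. -/
def SliceTwoCat.of (X : C) : SliceTwoCat P C := X

/-- A 0-cell of `U/(-)_* C` as an object of `C`. -/
def SliceTwoCat.to (X : SliceTwoCat P C) : C := X

/-- The parameter object `U` of a 1-cell `(U, f)`. -/
def param {X Y : SliceTwoCat P C} (f : X ⟶ Y) : P.FullSubcategory :=
  CostructuredArrow.left (S := P.ι) (T := X.to ⟶[W] Y.to) f

/-- The arrow `f` of a 1-cell `(U, f)`. -/
def arrow {X Y : SliceTwoCat P C} (f : X ⟶ Y) : (param f).obj ⟶ (X.to ⟶[W] Y.to) :=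
  CostructuredArrow.hom (S := P.ι) (T := X.to ⟶[W] Y.to) f

/-- The 1-cell `(U, f)`. -/
def cell₁ {X Y : SliceTwoCat P C} (U : P.FullSubcategory) (f : U.obj ⟶ (X.to ⟶[W] Y.to)) : X ⟶ Y :=
  CostructuredArrow.mk (S := P.ι) (T := X.to ⟶[W] Y.to) (Y := U) f

/-- The 2-cell `(U, f) ⟶ (V, g)` given by a reparametrization `φ : U ⟶ V` with `φ ≫ g = f`. -/
def cell₂ {X Y : SliceTwoCat P C} {f g : X ⟶ Y} (φ : (param f).obj ⟶ (param g).obj)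
    (h : φ ≫ arrow g = arrow f) : f ⟶ g :=
  CostructuredArrow.homMk (S := P.ι) (T := X.to ⟶[W] Y.to) (ObjectProperty.homMk φ) h

/-- An arrow `I ⟶ C(X, Y)` of the underlying category of `C`, as a 1-cell with parameter object
the monoidal unit `I`. -/
def liftCell {X Y : C} (f : ForgetEnrichment.of W X ⟶ ForgetEnrichment.of W Y) :
    SliceTwoCat.of (P := P) X ⟶ SliceTwoCat.of Y :=
  cell₁ (𝟙_ P.FullSubcategory) (ForgetEnrichment.homTo W f)

theorem arrow_comp {X Y Z : SliceTwoCat P C} (f : X ⟶ Y) (g : Y ⟶ Z) :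
    arrow (f ≫ g) = (arrow f ⊗ₘ arrow g) ≫ eComp W X.to Y.to Z.to := rfl

theorem arrow_id (X : SliceTwoCat P C) : arrow (𝟙 X) = 𝟙 (𝟙_ W) ≫ eId W X.to := rfl

variable (P C) in
/-- The data of the inclusion `C₀ ⟶ U/(-)_* C` of the underlying category of `C`, seen as a
2-category with only identity 2-cells: it is the identity on objects and sends `f : I ⟶ C(X, Y)` to
the 1-cell `(I, f)`. -/
def inclusionData :
    PrelaxFunctorStruct (LocallyDiscrete (ForgetEnrichment W C)) (SliceTwoCat P C) where
  obj X := SliceTwoCat.of (ForgetEnrichment.to W X.as)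
  map {X Y} f := liftCell (X := ForgetEnrichment.to W X.as) (Y := ForgetEnrichment.to W Y.as) f.as
  map₂ η := eqToHom (by rw [LocallyDiscrete.eq_of_hom η])

variable [SymmetricCategory W]

variable (P) in
/-- The functor `U/C(A₁, B₁) × U/C(A₂, B₂) ⥤ U/(C(A₁, B₁) ⊗ C(A₂, B₂)) ⥤ U/C(A₁ ⊠ A₂, B₁ ⊠ B₂)`
which defines the monoidal product of `U/(-)_* C` on 1-cells and 2-cells. -/
def boxFunctor (T : EnrichedFunctor W (C × C) C) (X Y : C × C) :
    CostructuredArrow P.ι (X.1 ⟶[W] Y.1) × CostructuredArrow P.ι (X.2 ⟶[W] Y.2) ⥤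
      CostructuredArrow P.ι (T.obj X ⟶[W] T.obj Y) :=
  (Functor.LaxMonoidal.μ (partialSlice P) (X.1 ⟶[W] Y.1) (X.2 ⟶[W] Y.2) ≫
    (partialSlice P).map (T.map X Y)).toFunctor

/-- The monoidal product of `U/(-)_* C` on 0-, 1- and 2-cells. -/
def boxData (T : EnrichedFunctor W (C × C) C) :
    PrelaxFunctorStruct (SliceTwoCat P C × SliceTwoCat P C) (SliceTwoCat P C) where
  obj X := SliceTwoCat.of (T.obj (X.1.to, X.2.to))
  map {X Y} f := (boxFunctor P T (X.1.to, X.2.to) (Y.1.to, Y.2.to)).obj f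
  map₂ {X Y} f g η := (boxFunctor P T (X.1.to, X.2.to) (Y.1.to, Y.2.to)).map (X := f) (Y := g) η

theorem arrow_box (T : EnrichedFunctor W (C × C) C) {X Y : SliceTwoCat P C × SliceTwoCat P C}
    (f : X ⟶ Y) : arrow ((boxData T).map f) =
      (arrow f.1 ⊗ₘ arrow f.2) ≫ T.map (X.1.to, X.2.to) (Y.1.to, Y.2.to) := rfl

/-- The data of the nearly strict monoidal structure on `U/(-)_* C` induced by a monoidal
`W`-category structure on `C`: the tensorators are the middle-four interchange symmetries
`(U₁ ⊗ U₂) ⊗ (V₁ ⊗ V₂) ⟶ (U₁ ⊗ V₁) ⊗ (U₂ ⊗ V₂)` of `W`, and the coherence 1-cells are those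
of `C`. -/
def MonoidalVCategory.liftData (M : MonoidalVCategory W C) :
    NearlyStrictMonoidalData (SliceTwoCat P C) where
  tensor := boxData M.tensor
  unit := SliceTwoCat.of M.unit
  tensorUnitor X := cell₂ (λ_ (𝟙_ W)).inv (unit_lift _ _ _ _ (M.tensor.map_id (X.1.to, X.2.to)))
  tensorator {X Y Z} f g :=
    cell₂ (tensorμ (param f.1).obj (param f.2).obj (param g.1).obj (param g.2).obj) 
      (comp_lift _ _ _ _ _ _ _ _ _ _ (M.tensor.map_comp (X.1.to, X.2.to) (Y.1.to, Y.2.to) (Z.1.to, Z.2.to)))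
  associator X Y Z := liftCell (X := M.tensor.obj (M.tensor.obj (X.to, Y.to), Z.to))
    (Y := M.tensor.obj (X.to, M.tensor.obj (Y.to, Z.to))) (M.associator.app ((X.to, Y.to), Z.to))
  leftUnitor X := liftCell (X := M.tensor.obj (M.unit, X.to)) (Y := X.to) (M.leftUnitor.app X.to)
  rightUnitor X := liftCell (X := M.tensor.obj (X.to, M.unit)) (Y := X.to) (M.rightUnitor.app X.to)

/-- The data of the nearly strict symmetric monoidal structure on `U/(-)_* C` induced by a symmetric
monoidal `W`-category structure on `C`: the symmetry 1-cells are those of `C`, and their naturality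
2-cells at `fᵢ : Uᵢ ⟶ C(Aᵢ, Bᵢ)` are the symmetries `U₂ ⊗ U₁ ⟶ U₁ ⊗ U₂` of `W` (up to the
identities `I ⊗ (U₂ ⊗ U₁) = U₂ ⊗ U₁` and `(U₁ ⊗ U₂) ⊗ I = U₁ ⊗ U₂`). -/
def SymmetricMonoidalVCategory.liftData (M : SymmetricMonoidalVCategory W C) :
    NearlyStrictSymmetricMonoidalData (SliceTwoCat P C) where
  toNearlyStrictMonoidalData := M.toMonoidalVCategory.liftData
  braiding X Y := liftCell (X := M.tensor.obj (X.to, Y.to)) (Y := M.tensor.obj (Y.to, X.to))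
    (M.braiding.app (X.to, Y.to))
  braidingCell {X Y} f :=
    cell₂ ((λ_ ((param f.2).obj ⊗ (param f.1).obj)).hom ≫ (β_ (param f.2).obj (param f.1).obj).hom ≫
      (ρ_ ((param f.1).obj ⊗ (param f.2).obj)).inv) 
      (braiding_lift _ _ _ _ _ _ _ _ (M.braiding.naturality (X.1.to, X.2.to) (Y.1.to, Y.2.to)))

variable (P) in
/-- The inclusion `C₀ ⟶ U/(-)_* C` strictly preserves the monoidal structure: it preserves the
monoidal product on 0-cells and 1-cells, the unit object and the coherence 1-cells by equalities,
and the unit constraints and tensorators of `U/(-)_* C` on its image are identities. -/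
structure MonoidalVCategory.InclusionStrict (M : MonoidalVCategory W C) : Prop where
  tensor_obj (X Y : C) : (inclusionData P C).obj ⟨.of W (M.tensor.obj (X, Y))⟩ =
    (M.liftData (P := P)).tensor.obj
      ((inclusionData P C).obj ⟨.of W X⟩, (inclusionData P C).obj ⟨.of W Y⟩)
  unit : (inclusionData P C).obj ⟨.of W M.unit⟩ = (M.liftData (P := P)).unit
  tensor_map {X₁ Y₁ X₂ Y₂ : C} (f₁ : ForgetEnrichment.of W X₁ ⟶ ForgetEnrichment.of W Y₁)
    (f₂ : ForgetEnrichment.of W X₂ ⟶ ForgetEnrichment.of W Y₂) :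
    (inclusionData P C).map (tensorHom₀ M.tensor f₁ f₂).toLoc =
      (M.liftData (P := P)).tensor.map
        (Prod.mkHom ((inclusionData P C).map f₁.toLoc) ((inclusionData P C).map f₂.toLoc))
  tensorUnitor (X Y : C) : ∃ h, (M.liftData (P := P)).tensorUnitor
    ((inclusionData P C).obj ⟨.of W X⟩, (inclusionData P C).obj ⟨.of W Y⟩) = eqToHom h
  tensorator {X₁ Y₁ Z₁ X₂ Y₂ Z₂ : C} (f₁ : ForgetEnrichment.of W X₁ ⟶ ForgetEnrichment.of W Y₁)
    (f₂ : ForgetEnrichment.of W X₂ ⟶ ForgetEnrichment.of W Y₂)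
    (g₁ : ForgetEnrichment.of W Y₁ ⟶ ForgetEnrichment.of W Z₁)
    (g₂ : ForgetEnrichment.of W Y₂ ⟶ ForgetEnrichment.of W Z₂) :
    ∃ h, (M.liftData (P := P)).tensorator
      (Prod.mkHom ((inclusionData P C).map f₁.toLoc) ((inclusionData P C).map f₂.toLoc))
      (Prod.mkHom ((inclusionData P C).map g₁.toLoc) ((inclusionData P C).map g₂.toLoc)) =
        eqToHom h
  associator (X Y Z : C) : (inclusionData P C).map (M.associator.app ((X, Y), Z)).toLoc =
    (M.liftData (P := P)).associator ((inclusionData P C).obj ⟨.of W X⟩)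
      ((inclusionData P C).obj ⟨.of W Y⟩) ((inclusionData P C).obj ⟨.of W Z⟩)
  leftUnitor (X : C) : (inclusionData P C).map (M.leftUnitor.app X).toLoc =
    (M.liftData (P := P)).leftUnitor ((inclusionData P C).obj ⟨.of W X⟩)
  rightUnitor (X : C) : (inclusionData P C).map (M.rightUnitor.app X).toLoc =
    (M.liftData (P := P)).rightUnitor ((inclusionData P C).obj ⟨.of W X⟩)

variable (P) in
/-- In the symmetric case the inclusion moreover preserves the symmetry 1-cells by equalities, and
the naturality 2-cells of the symmetry on its image are identities. -/
structure SymmetricMonoidalVCategory.InclusionStrict (M : SymmetricMonoidalVCategory W C) : Prop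
    extends M.toMonoidalVCategory.InclusionStrict P where
  braiding (X Y : C) : (inclusionData P C).map (M.braiding.app (X, Y)).toLoc =
    (M.liftData (P := P)).braiding ((inclusionData P C).obj ⟨.of W X⟩)
      ((inclusionData P C).obj ⟨.of W Y⟩)
  braidingCell {X₁ Y₁ X₂ Y₂ : C} (f₁ : ForgetEnrichment.of W X₁ ⟶ ForgetEnrichment.of W Y₁)
    (f₂ : ForgetEnrichment.of W X₂ ⟶ ForgetEnrichment.of W Y₂) :
    ∃ h, (M.liftData (P := P)).braidingCell
      (Prod.mkHom ((inclusionData P C).map f₁.toLoc) ((inclusionData P C).map f₂.toLoc)) =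
        eqToHom h

end ChangeOfBase

end PartialSlice

open PartialSlice

universe v₂

/-! A 2-cell of `N_*C` is a commuting triangle over a hom-object, so it is determined by its arrow
of parameter objects, here `reparam`. This assignment turns vertical composition into composition in
`W`, horizontal composition into `⊗`, and the identity coherence cells of the 2-category into
associators and unitors of `W` (`reparam_associator_hom` and its companions). Every axiom between
2-cells thereby becomes an equation in `W`, and the axioms for the product and the symmetry are
coherence properties of the middle-four interchange `tensorμ` and of the symmetry.

Equality of 1-cells is where strictness of `U` enters. By `cell_ext`, two 1-cells agree once a
transport of parameters, that is an `eqToHom` such as an associator or unitor of `U`, carries one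
arrow to the other. Naturality of a coherence 1-cell at `(U, f)` is the `W`-naturality hexagon
precomposed with `f` (`unitTrans_lift`). For `a`, `l` and `r` the parameters on the two sides differ
by associators and unitors only, so the squares commute strictly. For `s` they differ by the
symmetry, which need not be an identity, and an invertible 2-cell remains. In all four cases the
component has parameter `I`, and `unitStrongTrans` reduces the transformation axioms to conditions
on the arrows of parameters.

Pentagon, triangle, hexagon and the other equations between coherence 1-cells are images under `ι`
of the same equations in `C₀`, since `ι` preserves composition and `⊠` (`liftCell_comp`,
`liftCell_tensorHom₀`). On the image of `ι` all parameters are tensor powers of `I`, where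
interchange and symmetry are trivial. -/

namespace PartialSlice

/-! ### Transports along equalities of objects -/

section Structural

variable {W : Type u} [Category.{v} W]

/-- Arrows which are transports along an equality of objects. -/
def IsTransport {X Y : W} (a : X ⟶ Y) : Prop := ∃ h, a = eqToHom h

namespace IsTransport

theorem id (X : W) : IsTransport (𝟙 X) := ⟨rfl, rfl⟩

theorem comp {X Y Z : W} {a : X ⟶ Y} {b : Y ⟶ Z} (ha : IsTransport a) (hb : IsTransport b) :
    IsTransport (a ≫ b) := by
  obtain ⟨rfl, rfl⟩ := ha
  obtain ⟨rfl, rfl⟩ := hb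
  exact ⟨rfl, by simp⟩

theorem inv {X Y : W} {a : X ≅ Y} (ha : IsTransport a.hom) : IsTransport a.inv := by
  obtain ⟨h, e⟩ := ha
  exact ⟨h.symm, by rw [← cancel_epi a.hom, a.hom_inv_id, e, eqToHom_trans, eqToHom_refl]⟩

theorem unique {X Y : W} {a b : X ⟶ Y} (ha : IsTransport a) (hb : IsTransport b) : a = b := by
  obtain ⟨_, rfl⟩ := ha
  obtain ⟨_, rfl⟩ := hb
  rfl

variable [MonoidalCategory W] [IsStrictMonoidal W]

theorem associator (X Y Z : W) : IsTransport (α_ X Y Z).hom := associator_hom_eq X Y Z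

theorem leftUnitor_inv (X : W) : IsTransport (λ_ X).inv := leftUnitor_inv_eq X

theorem rightUnitor_inv (X : W) : IsTransport (ρ_ X).inv := rightUnitor_inv_eq X

theorem associator_inv (X Y Z : W) : IsTransport (α_ X Y Z).inv := (associator X Y Z).inv

theorem leftUnitor (X : W) : IsTransport (λ_ X).hom := (leftUnitor_inv X).inv (a := (λ_ X).symm)

theorem rightUnitor (X : W) : IsTransport (ρ_ X).hom := (rightUnitor_inv X).inv (a := (ρ_ X).symm)

theorem whiskerLeft {B : Type u} [Bicategory.{w, v} B] {X Y Z : B} (f : X ⟶ Y) {g h : Y ⟶ Z}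
    {η : g ⟶ h} (hη : IsTransport η) : IsTransport (Bicategory.whiskerLeft f η) := by
  obtain ⟨e, rfl⟩ := hη
  exact ⟨_, Bicategory.whiskerLeft_eqToHom f e⟩

theorem whiskerRight {B : Type u} [Bicategory.{w, v} B] {X Y Z : B} {f g : X ⟶ Y} {η : f ⟶ g}
    (hη : IsTransport η) (h : Y ⟶ Z) : IsTransport (Bicategory.whiskerRight η h) := by
  obtain ⟨e, rfl⟩ := hη
  exact ⟨_, Bicategory.eqToHom_whiskerRight e h⟩

end IsTransport

end Structural

/-! ### 2-cells as arrows of parameter objects -/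

section Reparametrization

variable {W : Type u} [Category.{v} W] [MonoidalCategory W]
  {P : ObjectProperty W} [P.IsMonoidal] [IsStrictMonoidal P.FullSubcategory]
  {C : Type u₁} [EnrichedCategory W C]

/-- The arrow of parameter objects underlying a 2-cell. -/
def reparam {X Y : SliceTwoCat P C} {f g : X ⟶ Y} (η : f ⟶ g) :
    (param f).obj ⟶ (param g).obj :=
  (CostructuredArrow.Hom.left (S := P.ι) (T := X.to ⟶[W] Y.to) η).hom

variable {X Y Z T : SliceTwoCat P C}

theorem reparam_arrow {f g : X ⟶ Y} (η : f ⟶ g) : reparam η ≫ arrow g = arrow f :=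
  CostructuredArrow.w (S := P.ι) (T := X.to ⟶[W] Y.to) η

/-- A 2-cell carries no data beyond its arrow of parameters. This is the step that moves each axiom
between 2-cells into `W`. -/
theorem reparam_injective {f g : X ⟶ Y} {η θ : f ⟶ g} (h : reparam η = reparam θ) : η = θ :=
  CostructuredArrow.hom_ext (S := P.ι) (T := X.to ⟶[W] Y.to) _ _
    (ObjectProperty.hom_ext _ h)

theorem reparam_comp {f g h : X ⟶ Y} (η : f ⟶ g) (θ : g ⟶ h) :
    reparam (η ≫ θ) = reparam η ≫ reparam θ := rfl

/-- Horizontal composition is the comparison functor of `N` followed by post-composition with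
`eComp`, and post-composition leaves parameters untouched. -/
theorem reparam_hComp {f f' : X ⟶ Y} {g g' : Y ⟶ Z} (η : f ⟶ f') (θ : g ⟶ g') :
    reparam (CatEnriched.hComp η θ) = reparam η ⊗ₘ reparam θ := rfl

theorem reparam_whiskerLeft (f : X ⟶ Y) {g h : Y ⟶ Z} (η : g ⟶ h) :
    reparam (Bicategory.whiskerLeft f η) = (param f).obj ◁ reparam η :=
  (reparam_hComp (𝟙 f) η).trans (MonoidalCategory.id_tensorHom (param f).obj (reparam η))

theorem reparam_whiskerRight {f g : X ⟶ Y} (η : f ⟶ g) (h : Y ⟶ Z) :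
    reparam (Bicategory.whiskerRight η h) = reparam η ▷ (param h).obj :=
  (reparam_hComp η (𝟙 h)).trans (MonoidalCategory.tensorHom_id (reparam η) (param h).obj)

/-- Two 1-cells are equal if their arrows correspond under a transport of parameter objects. -/
theorem cell_ext {f g : X ⟶ Y} {a : param f ⟶ param g} (ha : IsTransport a)
    (h : a.hom ≫ arrow g = arrow f) : f = g :=
  obj_eq (A := X.to ⟶[W] Y.to) (f := arrow f) (g := arrow g) ha h

/-- The transport `a` is arbitrary because parallel transports coincide; it can thus be chosen to be
an associator or unitor of `U`. -/
theorem reparam_eqToHom {f g : X ⟶ Y} (h : f = g) {a : param f ⟶ param g}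
    (ha : IsTransport a) : reparam (eqToHom h) = a.hom := by
  subst h
  obtain ⟨_, rfl⟩ := ha
  rfl

/-- The equality of the two 1-cells need not be known beforehand: the triangle of `η` itself shows
that the transport matches their arrows. -/
theorem eq_eqToHom {f g : X ⟶ Y} (η : f ⟶ g) {a : param f ⟶ param g}
    (ha : IsTransport a) (h : reparam η = a.hom) : ∃ e, η = eqToHom e := by
  have e : f = g := cell_ext ha (by rw [← h]; exact reparam_arrow η)
  exact ⟨e, reparam_injective (h.trans (reparam_eqToHom e ha).symm)⟩

/-- In a strict bicategory the associator is an `eqToHom`, and the associator of `U` is a transport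
between the same parameters. Keeping it as `α` makes the coherence theorems of `W` applicable,
although `W` itself need not be strict. -/
theorem reparam_associator_hom (f : X ⟶ Y) (g : Y ⟶ Z) (h : Z ⟶ T) :
    reparam (Bicategory.associator f g h).hom =
      (α_ (param f).obj (param g).obj (param h).obj).hom := by
  rw [Bicategory.Strict.associator_eqToIso]
  exact reparam_eqToHom (Bicategory.Strict.assoc f g h)
    (IsTransport.associator (param f) (param g) (param h))

theorem reparam_associator_inv (f : X ⟶ Y) (g : Y ⟶ Z) (h : Z ⟶ T) :
    reparam (Bicategory.associator f g h).inv =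
      (α_ (param f).obj (param g).obj (param h).obj).inv := by
  rw [Bicategory.Strict.associator_eqToIso]
  exact reparam_eqToHom (Bicategory.Strict.assoc f g h).symm
    (IsTransport.associator_inv (param f) (param g) (param h))

theorem reparam_leftUnitor_hom (f : X ⟶ Y) :
    reparam (Bicategory.leftUnitor f).hom = (λ_ (param f).obj).hom := by
  rw [Bicategory.Strict.leftUnitor_eqToIso]
  exact reparam_eqToHom (Bicategory.Strict.id_comp f) (IsTransport.leftUnitor (param f))

theorem reparam_leftUnitor_inv (f : X ⟶ Y) :
    reparam (Bicategory.leftUnitor f).inv = (λ_ (param f).obj).inv := by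
  rw [Bicategory.Strict.leftUnitor_eqToIso]
  exact reparam_eqToHom (Bicategory.Strict.id_comp f).symm
    (IsTransport.leftUnitor_inv (param f))

theorem reparam_rightUnitor_hom (f : X ⟶ Y) :
    reparam (Bicategory.rightUnitor f).hom = (ρ_ (param f).obj).hom := by
  rw [Bicategory.Strict.rightUnitor_eqToIso]
  exact reparam_eqToHom (Bicategory.Strict.comp_id f) (IsTransport.rightUnitor (param f))

theorem reparam_rightUnitor_inv (f : X ⟶ Y) :
    reparam (Bicategory.rightUnitor f).inv = (ρ_ (param f).obj).inv := by
  rw [Bicategory.Strict.rightUnitor_eqToIso]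
  exact reparam_eqToHom (Bicategory.Strict.comp_id f).symm
    (IsTransport.rightUnitor_inv (param f))

/-- A 2-cell given by an isomorphism of parameter objects is invertible. -/
@[simps]
def cellIso {f g : X ⟶ Y} (φ : (param f).obj ≅ (param g).obj)
    (h : φ.hom ≫ arrow g = arrow f) : f ≅ g where
  hom := cell₂ φ.hom h
  inv := cell₂ φ.inv (by rw [← h, Iso.inv_hom_id_assoc])
  hom_inv_id := reparam_injective φ.hom_inv_id
  inv_hom_id := reparam_injective φ.inv_hom_id

end Reparametrization

/-! ### The inclusion of the underlying category -/

section Inclusion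

variable {W : Type u} [Category.{v} W] [MonoidalCategory W]
  {P : ObjectProperty W} [P.IsMonoidal] [IsStrictMonoidal P.FullSubcategory]
  {C : Type u₁} [EnrichedCategory W C]

theorem liftCell_id (X : C) : liftCell (P := P) (𝟙 (ForgetEnrichment.of W X)) = 𝟙 _ := by
  refine cell_ext (IsTransport.id (𝟙_ P.FullSubcategory)) ?_
  exact (congrArg _ (Category.id_comp _)).trans ((Category.id_comp _).trans
    (ForgetEnrichment.homTo_id W X).symm)

/-- The parameters are `I` and `I ⊗ I`. The inverse unitor between them is a transport in `U`, and
it is also the arrow by which composition in `C₀` is defined. -/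
theorem liftCell_comp {X Y Z : C} (f : ForgetEnrichment.of W X ⟶ ForgetEnrichment.of W Y)
    (g : ForgetEnrichment.of W Y ⟶ ForgetEnrichment.of W Z) :
    liftCell (P := P) (f ≫ g) = liftCell f ≫ liftCell g :=
  cell_ext (f := liftCell (f ≫ g)) (g := liftCell f ≫ liftCell g)
    (IsTransport.leftUnitor_inv (𝟙_ P.FullSubcategory))
    ((Category.assoc _ _ _).symm.trans (ForgetEnrichment.homTo_comp W f g).symm)

theorem liftCell_comp_eq {X Y Z : C} {f : ForgetEnrichment.of W X ⟶ ForgetEnrichment.of W Y}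
    {g : ForgetEnrichment.of W Y ⟶ ForgetEnrichment.of W Z}
    {f' : SliceTwoCat.of (P := P) X ⟶ SliceTwoCat.of Y}
    {g' : SliceTwoCat.of (P := P) Y ⟶ SliceTwoCat.of Z} (hf : liftCell f = f')
    (hg : liftCell g = g') : liftCell (f ≫ g) = f' ≫ g' := by
  rw [liftCell_comp, hf, hg]

theorem liftCell_isInvertible {X Y : C} (f : ForgetEnrichment.of W X ⟶ ForgetEnrichment.of W Y)
    [IsIso f] : IsInvertible (liftCell (P := P) f) :=
  ⟨liftCell (CategoryTheory.inv f), by rw [← liftCell_comp, IsIso.hom_inv_id, liftCell_id],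
    by rw [← liftCell_comp, IsIso.inv_hom_id, liftCell_id]⟩

theorem isTransport_inclusionData_map₂ {X Y : LocallyDiscrete (ForgetEnrichment W C)}
    {f g : X ⟶ Y} (η : f ⟶ g) : IsTransport ((inclusionData P C).map₂ η) :=
  ⟨congrArg _ (LocallyDiscrete.eq_of_hom η), rfl⟩

variable (P C) in
/-- The inclusion of the underlying category as a strict 2-functor. -/
def inclusion : StrictPseudofunctor (LocallyDiscrete (ForgetEnrichment W C)) (SliceTwoCat P C) :=
  .mk''
  { inclusionData P C with
    map₂_id _ := rfl
    map₂_comp _ _ := IsTransport.unique (isTransport_inclusionData_map₂ _)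
      ((isTransport_inclusionData_map₂ _).comp (isTransport_inclusionData_map₂ _))
    map_id X := liftCell_id (P := P) (ForgetEnrichment.to W X.as)
    map_comp {X Y Z} f g := liftCell_comp (P := P) (X := ForgetEnrichment.to W X.as)
      (Y := ForgetEnrichment.to W Y.as) (Z := ForgetEnrichment.to W Z.as) f.as g.as
    map₂_whisker_left f _ _ η := by
      -- The outer factors are the `eqToHom`s for preservation of composition; whiskering keeps the
      -- middle factor a transport, so both sides are parallel transports.
      refine IsTransport.unique (isTransport_inclusionData_map₂ _)
        (.comp ⟨_, rfl⟩ (.comp ?_ ⟨_, rfl⟩))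
      exact (isTransport_inclusionData_map₂ η).whiskerLeft _
    map₂_whisker_right η g := by
      refine IsTransport.unique (isTransport_inclusionData_map₂ _)
        (.comp ⟨_, rfl⟩ (.comp ?_ ⟨_, rfl⟩))
      exact (isTransport_inclusionData_map₂ η).whiskerRight _ }

end Inclusion

/-! ### The product as a pseudofunctor -/

section Box

variable {W : Type u} [Category.{v} W] [MonoidalCategory W] [SymmetricCategory W]
  {P : ObjectProperty W} [P.IsMonoidal] [IsStrictMonoidal P.FullSubcategory]
  {C : Type u₁} [EnrichedCategory W C]

/-- The middle-four interchange as an isomorphism. -/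
@[simps]
def tensorμIso (X₁ X₂ Y₁ Y₂ : W) : (X₁ ⊗ X₂) ⊗ (Y₁ ⊗ Y₂) ≅ (X₁ ⊗ Y₁) ⊗ (X₂ ⊗ Y₂) where
  hom := tensorμ X₁ X₂ Y₁ Y₂
  inv := tensorδ X₁ X₂ Y₁ Y₂

theorem reparam_box (T : EnrichedFunctor W (C × C) C) {X Y : SliceTwoCat P C × SliceTwoCat P C}
    {f g : X ⟶ Y} (η : f ⟶ g) :
    reparam ((boxData T).map₂ η) = reparam η.1 ⊗ₘ reparam η.2 := rfl

/-- The unit constraint of the monoidal product. -/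
def boxUnitIso (T : EnrichedFunctor W (C × C) C) (X : SliceTwoCat P C × SliceTwoCat P C) :
    𝟙 ((boxData T).obj X) ≅ (boxData T).map (𝟙 X) :=
  cellIso (λ_ (𝟙_ W)).symm (unit_lift _ _ _ _ (T.map_id (X.1.to, X.2.to)))

/-- The tensorator of the monoidal product. -/
def boxCompIso (T : EnrichedFunctor W (C × C) C) {X Y Z : SliceTwoCat P C × SliceTwoCat P C}
    (f : X ⟶ Y) (g : Y ⟶ Z) :
    (boxData T).map f ≫ (boxData T).map g ≅ (boxData T).map (f ≫ g) :=
  cellIso (tensorμIso (param f.1).obj (param f.2).obj (param g.1).obj (param g.2).obj)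
    (comp_lift _ _ _ _ _ _ _ _ _ _
      (T.map_comp (X.1.to, X.2.to) (Y.1.to, Y.2.to) (Z.1.to, Z.2.to)))

/-- This identity and the four after it are the pseudofunctor axioms involving composition, read on
parameter objects. Each is a naturality or coherence property of `tensorμ`, with interchanges moved
across by means of the inverse `tensorδ`. -/
theorem whiskerLeft_tensorHom_whiskerLeft (X₁ X₂ : W) {Y₁ Y₂ Z₁ Z₂ : W} (f : Y₁ ⟶ Z₁)
    (g : Y₂ ⟶ Z₂) : X₁ ◁ f ⊗ₘ X₂ ◁ g =
      tensorδ X₁ X₂ Y₁ Y₂ ≫ (X₁ ⊗ X₂) ◁ (f ⊗ₘ g) ≫ tensorμ X₁ X₂ Z₁ Z₂ := by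
  rw [tensorμ_natural_right, tensorδ_tensorμ_assoc]

theorem whiskerRight_tensorHom_whiskerRight {Y₁ Y₂ Z₁ Z₂ : W} (f : Y₁ ⟶ Z₁) (g : Y₂ ⟶ Z₂)
    (X₁ X₂ : W) : f ▷ X₁ ⊗ₘ g ▷ X₂ =
      tensorδ Y₁ Y₂ X₁ X₂ ≫ (f ⊗ₘ g) ▷ (X₁ ⊗ X₂) ≫ tensorμ Z₁ Z₂ X₁ X₂ := by
  rw [tensorμ_natural_left, tensorδ_tensorμ_assoc]

theorem associator_tensorHom_associator (X₁ X₂ Y₁ Y₂ Z₁ Z₂ : W) :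
    (α_ X₁ Y₁ Z₁).hom ⊗ₘ (α_ X₂ Y₂ Z₂).hom =
      tensorδ (X₁ ⊗ Y₁) (X₂ ⊗ Y₂) Z₁ Z₂ ≫ tensorδ X₁ X₂ Y₁ Y₂ ▷ (Z₁ ⊗ Z₂) ≫
        (α_ (X₁ ⊗ X₂) (Y₁ ⊗ Y₂) (Z₁ ⊗ Z₂)).hom ≫
          (X₁ ⊗ X₂) ◁ tensorμ Y₁ Y₂ Z₁ Z₂ ≫ tensorμ X₁ X₂ (Y₁ ⊗ Z₁) (Y₂ ⊗ Z₂) := by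
  rw [← tensor_associativity, ← comp_whiskerRight_assoc, tensorδ_tensorμ, id_whiskerRight,
    Category.id_comp, tensorδ_tensorμ_assoc]

theorem leftUnitor_tensorHom_leftUnitor (X₁ X₂ : W) : (λ_ X₁).hom ⊗ₘ (λ_ X₂).hom =
    tensorδ (𝟙_ W) (𝟙_ W) X₁ X₂ ≫ (λ_ (𝟙_ W)).hom ▷ (X₁ ⊗ X₂) ≫ (λ_ (X₁ ⊗ X₂)).hom := by
  rw [tensor_left_unitality, hom_inv_whiskerRight_assoc, tensorδ_tensorμ_assoc]

theorem rightUnitor_tensorHom_rightUnitor (X₁ X₂ : W) : (ρ_ X₁).hom ⊗ₘ (ρ_ X₂).hom =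
    tensorδ X₁ X₂ (𝟙_ W) (𝟙_ W) ≫ (X₁ ⊗ X₂) ◁ (λ_ (𝟙_ W)).hom ≫ (ρ_ (X₁ ⊗ X₂)).hom := by
  rw [tensor_right_unitality, whiskerLeft_hom_inv_assoc, tensorδ_tensorμ_assoc]

/-- The monoidal product of `U/(-)_* C` as a pseudofunctor. -/
def boxPseudofunctor (T : EnrichedFunctor W (C × C) C) :
    Pseudofunctor (SliceTwoCat P C × SliceTwoCat P C) (SliceTwoCat P C) where
  toPrelaxFunctorStruct := boxData T
  map₂_id f := reparam_injective (id_tensorHom_id ..)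
  map₂_comp η θ := reparam_injective (tensorHom_comp_tensorHom ..).symm
  -- Pseudofunctor comparisons point from the image of a composite to the composite of images,
  -- against the tensorator, so the forward cell of `mapComp` has parameter arrow `tensorδ`.
  mapId X := (boxUnitIso T X).symm
  mapComp f g := (boxCompIso T f g).symm
  map₂_whisker_left f g h η := by
    -- The five remaining axioms share one pattern: pass to parameter arrows, evaluate both
    -- components of the product, then apply the matching interchange identity.
    apply reparam_injective
    refine (reparam_box T _).trans ?_
    refine (congrArg₂ _ (reparam_whiskerLeft f.1 η.1) (reparam_whiskerLeft f.2 η.2)).trans ?_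
    refine (whiskerLeft_tensorHom_whiskerLeft ..).trans ?_
    simp only [reparam_comp, reparam_whiskerLeft]
    rfl
  map₂_whisker_right η h := by
    apply reparam_injective
    refine (reparam_box T _).trans ?_
    refine (congrArg₂ _ (reparam_whiskerRight η.1 h.1) (reparam_whiskerRight η.2 h.2)).trans ?_
    refine (whiskerRight_tensorHom_whiskerRight ..).trans ?_
    simp only [reparam_comp, reparam_whiskerRight]
    rfl
  map₂_associator f g h := by
    apply reparam_injective
    refine (reparam_box T _).trans ?_
    refine (congrArg₂ _ (reparam_associator_hom f.1 g.1 h.1)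
      (reparam_associator_hom f.2 g.2 h.2)).trans ?_
    refine (associator_tensorHom_associator ..).trans ?_
    simp only [reparam_comp, reparam_whiskerRight, reparam_whiskerLeft, reparam_associator_hom]
    rfl
  map₂_left_unitor f := by
    apply reparam_injective
    refine (reparam_box T _).trans ?_
    refine (congrArg₂ _ (reparam_leftUnitor_hom f.1) (reparam_leftUnitor_hom f.2)).trans ?_
    refine (leftUnitor_tensorHom_leftUnitor ..).trans ?_
    simp only [reparam_comp, reparam_whiskerRight, reparam_leftUnitor_hom]
    rfl
  map₂_right_unitor f := by
    apply reparam_injective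
    refine (reparam_box T _).trans ?_
    refine (congrArg₂ _ (reparam_rightUnitor_hom f.1) (reparam_rightUnitor_hom f.2)).trans ?_
    refine (rightUnitor_tensorHom_rightUnitor ..).trans ?_
    simp only [reparam_comp, reparam_whiskerLeft, reparam_rightUnitor_hom]
    rfl

end Box

/-! ### Strong transformations whose components have parameter `I` -/

section UnitTrans

variable {W : Type u} [Category.{v} W] [MonoidalCategory W]

/-- Precomposing the `W`-naturality hexagon `h` on the hom-object `H` with `u : U ⟶ H` gives
naturality at a parametrized 1-cell. The unitors around `k` absorb the factor `I` that the component
contributes on either side. -/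
theorem unitTrans_lift {U V H X Y S T Z : W} {x : U ⟶ X} {y : V ⟶ Y} (k : U ⟶ V) (u : U ⟶ H)
    {m₁ : H ⟶ X} {m₂ : H ⟶ Y} {s : 𝟙_ W ⟶ S} {s' : 𝟙_ W ⟶ T} {c : S ⊗ Y ⟶ Z} {c' : X ⊗ T ⟶ Z}
    (hx : x = u ≫ m₁) (hy : k ≫ y = u ≫ m₂)
    (h : (λ_ H).inv ≫ (s ⊗ₘ m₂) ≫ c = (ρ_ H).inv ≫ (m₁ ⊗ₘ s') ≫ c') :
    ((ρ_ U).hom ≫ k ≫ (λ_ V).inv) ≫ (s ⊗ₘ y) ≫ c = (x ⊗ₘ s') ≫ c' := by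
  have h₁ : x ⊗ₘ s' = (u ▷ 𝟙_ W) ≫ (m₁ ⊗ₘ s') := by
    rw [← tensorHom_id, tensorHom_comp_tensorHom, Category.id_comp, hx]
  have h₂ : k ≫ (λ_ V).inv ≫ (s ⊗ₘ y) = u ≫ (λ_ H).inv ≫ (s ⊗ₘ m₂) := by
    rw [leftUnitor_inv_naturality_assoc, leftUnitor_inv_naturality_assoc, ← id_tensorHom,
      ← id_tensorHom, tensorHom_comp_tensorHom, tensorHom_comp_tensorHom, Category.id_comp, hy]
  simp only [Category.assoc]
  rw [reassoc_of% h₂, h, h₁, Category.assoc, rightUnitor_inv_naturality_assoc,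
    Iso.hom_inv_id_assoc]

/-- This identity and the two below are the axioms of a strong transformation on parameter objects.
Once the unitors are moved past by naturality, only a condition on `k` is left. -/
theorem unitTrans_naturality {A A' B B' : W} (x : A ⟶ A') (y : B ⟶ B') (k : A ⟶ B)
    (k' : A' ⟶ B') (h : x ≫ k' = k ≫ y) :
    x ▷ 𝟙_ W ≫ (ρ_ A').hom ≫ k' ≫ (λ_ B').inv =
      ((ρ_ A).hom ≫ k ≫ (λ_ B).inv) ≫ 𝟙_ W ◁ y := by
  rw [rightUnitor_naturality_assoc, reassoc_of% h, leftUnitor_inv_naturality]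
  simp only [Category.assoc]

theorem unitTrans_id {A B : W} (x : A ⟶ 𝟙_ W) (y : B ⟶ 𝟙_ W) (k : A ⟶ B) (h : k ≫ y = x) :
    ((ρ_ A).hom ≫ k ≫ (λ_ B).inv) ≫ 𝟙_ W ◁ y =
      x ▷ 𝟙_ W ≫ (λ_ (𝟙_ W)).hom ≫ (ρ_ (𝟙_ W)).inv := by
  rw [unitors_equal, ← unitors_inv_equal, rightUnitor_naturality_assoc, ← h]
  simp only [Category.assoc, leftUnitor_inv_naturality, MonoidalCategory.whiskerLeft_comp]

theorem unitTrans_comp {A A₁ A₂ B B₁ B₂ : W} (x : A ⟶ A₁ ⊗ A₂) (y : B ⟶ B₁ ⊗ B₂) (k : A ⟶ B)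
    (k₁ : A₁ ⟶ B₁) (k₂ : A₂ ⟶ B₂) (h : k ≫ y = x ≫ (k₁ ⊗ₘ k₂)) :
    ((ρ_ A).hom ≫ k ≫ (λ_ B).inv) ≫ 𝟙_ W ◁ y =
      x ▷ 𝟙_ W ≫ (α_ A₁ A₂ (𝟙_ W)).hom ≫ A₁ ◁ ((ρ_ A₂).hom ≫ k₂ ≫ (λ_ B₂).inv) ≫
        (α_ A₁ (𝟙_ W) B₂).inv ≫ ((ρ_ A₁).hom ≫ k₁ ≫ (λ_ B₁).inv) ▷ B₂ ≫
          (α_ (𝟙_ W) B₁ B₂).hom := by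
  have h' : ((ρ_ A).hom ≫ k ≫ (λ_ B).inv) ≫ 𝟙_ W ◁ y =
      (ρ_ A).hom ≫ x ≫ (k₁ ⊗ₘ k₂) ≫ (λ_ (B₁ ⊗ B₂)).inv := by
    rw [← reassoc_of% h, Category.assoc, Category.assoc, leftUnitor_inv_naturality,
      leftUnitor_inv_naturality_assoc]
  -- The primed splitting of `k₁ ⊗ₘ k₂` applies `k₂` before `k₁`, the order in which the two
  -- naturality cells are pasted.
  rw [h', ← rightUnitor_naturality_assoc, MonoidalCategory.tensorHom_def']
  congr 1
  monoidal

variable {P : ObjectProperty W} [P.IsMonoidal] [IsStrictMonoidal P.FullSubcategory]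
  {C : Type u₁} [EnrichedCategory W C]

/-- A strong transformation whose components have parameter object `I`, from invertible naturality
2-cells which, up to the identities `U ⊗ I = U` and `V = I ⊗ V`, form a natural family `k` of
arrows of parameter objects compatible with units and composition. -/
def unitStrongTrans {B : Type u₂} [Bicategory.{w, v₂} B] (F G : Pseudofunctor B (SliceTwoCat P C))
    (s : ∀ a, 𝟙_ W ⟶ ((F.obj a).to ⟶[W] (G.obj a).to))
    (θ : ∀ {a b : B} (f : a ⟶ b), F.map f ≫ cell₁ (𝟙_ P.FullSubcategory) (s b) ≅
      cell₁ (𝟙_ P.FullSubcategory) (s a) ≫ G.map f)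
    (k : ∀ {a b : B} (f : a ⟶ b), (param (F.map f)).obj ⟶ (param (G.map f)).obj)
    (hθ : ∀ {a b : B} (f : a ⟶ b), reparam (θ f).hom =
      (ρ_ (param (F.map f)).obj).hom ≫ k f ≫ (λ_ (param (G.map f)).obj).inv)
    (hnat : ∀ {a b : B} {f g : a ⟶ b} (η : f ⟶ g),
      reparam (F.map₂ η) ≫ k g = k f ≫ reparam (G.map₂ η))
    (hid : ∀ a, k (𝟙 a) ≫ reparam (G.mapId a).hom = reparam (F.mapId a).hom)
    (hcomp : ∀ {a b c : B} (f : a ⟶ b) (g : b ⟶ c),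
      k (f ≫ g) ≫ reparam (G.mapComp f g).hom = reparam (F.mapComp f g).hom ≫ (k f ⊗ₘ k g)) :
    F.StrongTrans G where
  app a := cell₁ (𝟙_ P.FullSubcategory) (s a)
  naturality f := θ f
  naturality_naturality η := by
    apply reparam_injective
    simp only [reparam_comp, reparam_whiskerRight, reparam_whiskerLeft, hθ]
    exact unitTrans_naturality _ _ _ _ (hnat η)
  naturality_id a := by
    apply reparam_injective
    simp only [reparam_comp, reparam_whiskerRight, reparam_whiskerLeft, hθ,
      reparam_leftUnitor_hom, reparam_rightUnitor_inv]
    exact unitTrans_id _ _ _ (hid a)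
  naturality_comp f g := by
    apply reparam_injective
    simp only [reparam_comp, reparam_whiskerRight, reparam_whiskerLeft, hθ,
      reparam_associator_hom, reparam_associator_inv]
    exact unitTrans_comp _ _ _ _ _ (hcomp f g)

end UnitTrans

/-! ### Coherence identities for the parameters of `a`, `l`, `r` and `s` -/

section Coherence

variable {W : Type u} [Category.{v} W] [MonoidalCategory W]

/-- Like the next three lemmas, this factors the arrow of a product of 1-cells through the action of
a composite `W`-functor, the shape `u ≫ m` required by `unitTrans_lift`. -/
theorem tensorHom_comp_tensorHom_comp {U V X Y Z T : W} (f : U ⟶ X) (g : V ⟶ Y) (t : X ⟶ Z)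
    (t' : Z ⊗ Y ⟶ T) : ((f ≫ t) ⊗ₘ g) ≫ t' = (f ⊗ₘ g) ≫ (t ⊗ₘ 𝟙 Y) ≫ t' := by
  rw [tensorHom_comp_tensorHom_assoc, Category.comp_id]

theorem associator_tensorHom_comp {U₁ U₂ U₃ X₁ X₂ X₃ Z T : W} (f₁ : U₁ ⟶ X₁) (f₂ : U₂ ⟶ X₂)
    (f₃ : U₃ ⟶ X₃) (t : X₂ ⊗ X₃ ⟶ Z) (t' : X₁ ⊗ Z ⟶ T) :
    (α_ U₁ U₂ U₃).hom ≫ (f₁ ⊗ₘ ((f₂ ⊗ₘ f₃) ≫ t)) ≫ t' =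
      ((f₁ ⊗ₘ f₂) ⊗ₘ f₃) ≫ (α_ X₁ X₂ X₃).hom ≫ (𝟙 X₁ ⊗ₘ t) ≫ t' := by
  rw [associator_naturality_assoc, tensorHom_comp_tensorHom_assoc, Category.comp_id]

theorem insertLeft_lift {U X J Z : W} (f : U ⟶ X) (e : 𝟙_ W ⟶ J) (t : J ⊗ X ⟶ Z) :
    ((𝟙 (𝟙_ W) ≫ e) ⊗ₘ f) ≫ t = ((λ_ U).hom ≫ f) ≫ ((λ_ X).inv ≫ e ▷ X) ≫ t := by
  simp only [Category.assoc, Category.id_comp]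
  rw [leftUnitor_inv_naturality_assoc, Iso.hom_inv_id_assoc, whisker_exchange_assoc,
    MonoidalCategory.tensorHom_def, Category.assoc]

theorem insertRight_lift {U X J Z : W} (f : U ⟶ X) (e : 𝟙_ W ⟶ J) (t : X ⊗ J ⟶ Z) :
    (f ⊗ₘ (𝟙 (𝟙_ W) ≫ e)) ≫ t = ((ρ_ U).hom ≫ f) ≫ ((ρ_ X).inv ≫ X ◁ e) ≫ t := by
  simp only [Category.assoc, Category.id_comp]
  rw [rightUnitor_inv_naturality_assoc, Iso.hom_inv_id_assoc,
    MonoidalCategory.tensorHom_def, Category.assoc]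

theorem associator_comp_unit :
    (α_ (𝟙_ W) (𝟙_ W) (𝟙_ W)).hom ≫ (𝟙 (𝟙_ W) ⊗ₘ (𝟙 (𝟙_ W) ⊗ₘ 𝟙 (𝟙_ W))) ≫
        (𝟙 (𝟙_ W) ⊗ₘ (λ_ (𝟙_ W)).hom) ≫ (λ_ (𝟙_ W)).hom =
      ((λ_ (𝟙_ W)).hom ⊗ₘ 𝟙 (𝟙_ W)) ≫ (λ_ (𝟙_ W)).hom := by
  monoidal

variable [SymmetricCategory W]

theorem associator_comp_tensorδ (X₁ X₂ X₃ Y₁ Y₂ Y₃ : W) :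
    (α_ (X₁ ⊗ Y₁) (X₂ ⊗ Y₂) (X₃ ⊗ Y₃)).hom ≫ (X₁ ⊗ Y₁) ◁ tensorδ X₂ X₃ Y₂ Y₃ ≫
        tensorδ X₁ (X₂ ⊗ X₃) Y₁ (Y₂ ⊗ Y₃) =
      tensorδ X₁ X₂ Y₁ Y₂ ▷ (X₃ ⊗ Y₃) ≫ tensorδ (X₁ ⊗ X₂) X₃ (Y₁ ⊗ Y₂) Y₃ ≫
        ((α_ X₁ X₂ X₃).hom ⊗ₘ (α_ Y₁ Y₂ Y₃).hom) := by
  -- Composing with two interchange isomorphisms cancels the `tensorδ`s and leaves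
  -- `associator_monoidal`.
  rw [← cancel_mono (tensorμIso X₁ (X₂ ⊗ X₃) Y₁ (Y₂ ⊗ Y₃)).hom,
    ← cancel_mono (whiskerLeftIso (X₁ ⊗ Y₁) (tensorμIso X₂ X₃ Y₂ Y₃)).hom]
  simp only [Category.assoc, tensorμIso_hom, whiskerLeftIso_hom]
  rw [← associator_monoidal, tensorδ_tensorμ_assoc, tensorδ_tensorμ_assoc,
    ← MonoidalCategory.whiskerLeft_comp, ← comp_whiskerRight_assoc, tensorδ_tensorμ]
  simp

theorem leftUnitor_comp_tensorδ (X Y : W) : (λ_ (X ⊗ Y)).hom =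
    (λ_ (𝟙_ W)).inv ▷ (X ⊗ Y) ≫ tensorδ (𝟙_ W) X (𝟙_ W) Y ≫ ((λ_ X).hom ⊗ₘ (λ_ Y).hom) := by
  rw [leftUnitor_monoidal, tensorδ_tensorμ_assoc, inv_hom_whiskerRight_assoc]

theorem rightUnitor_comp_tensorδ (X Y : W) : (ρ_ (X ⊗ Y)).hom =
    (X ⊗ Y) ◁ (λ_ (𝟙_ W)).inv ≫ tensorδ X (𝟙_ W) Y (𝟙_ W) ≫ ((ρ_ X).hom ⊗ₘ (ρ_ Y).hom) := by
  rw [rightUnitor_monoidal, tensorδ_tensorμ_assoc, whiskerLeft_inv_hom_assoc]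

/-- The inverse form of `tensorμ_comp_braiding` at identities; that lemma rests on the symmetry
being its own inverse. -/
theorem braiding_comp_tensorδ (X₁ X₂ Y₁ Y₂ : W) :
    (β_ (X₁ ⊗ Y₁) (X₂ ⊗ Y₂)).hom ≫ tensorδ X₂ X₁ Y₂ Y₁ =
      tensorδ X₁ X₂ Y₁ Y₂ ≫ ((β_ X₁ X₂).hom ⊗ₘ (β_ Y₁ Y₂).hom) := by
  have h := tensorμ_comp_braiding (𝟙 (X₁ ⊗ Y₁)) (𝟙 (X₂ ⊗ Y₂))
  simp only [id_tensorHom_id, Category.comp_id] at h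
  rw [← cancel_mono (tensorμIso X₂ X₁ Y₂ Y₁).hom, Category.assoc, Category.assoc,
    tensorμIso_hom, ← h, tensorδ_tensorμ, tensorδ_tensorμ_assoc, Category.comp_id]

/-- A symmetry with an argument `I` is a composite of unitors, so coherence applies. Hence
tensorators on the image of `ι` are identities. -/
theorem tensorμ_unit : tensorμ (𝟙_ W) (𝟙_ W) (𝟙_ W) (𝟙_ W) = 𝟙 _ := by
  simp only [tensorμ, braiding_tensorUnit_left]
  monoidal

/-- The primed versions retain the identity and unitor factors that the comparison cells of
composite pseudofunctors produce. -/
theorem associator_comp_tensorδ' (X₁ X₂ X₃ Y₁ Y₂ Y₃ : W) :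
    (α_ (X₁ ⊗ Y₁) (X₂ ⊗ Y₂) (X₃ ⊗ Y₃)).hom ≫
        (𝟙 (X₁ ⊗ Y₁) ⊗ₘ (𝟙 (X₂ ⊗ Y₂) ⊗ₘ 𝟙 (X₃ ⊗ Y₃))) ≫
          (𝟙 (X₁ ⊗ Y₁) ⊗ₘ tensorδ X₂ X₃ Y₂ Y₃) ≫ tensorδ X₁ (X₂ ⊗ X₃) Y₁ (Y₂ ⊗ Y₃) =
      ((tensorδ X₁ X₂ Y₁ Y₂ ⊗ₘ 𝟙 (X₃ ⊗ Y₃)) ≫ tensorδ (X₁ ⊗ X₂) X₃ (Y₁ ⊗ Y₂) Y₃) ≫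
        ((α_ X₁ X₂ X₃).hom ⊗ₘ (α_ Y₁ Y₂ Y₃).hom) := by
  rw [id_tensorHom_id, id_tensorHom_id, Category.id_comp, id_tensorHom, tensorHom_id,
    Category.assoc, associator_comp_tensorδ]

theorem leftUnitor_comp_tensorδ' (X Y : W) : (λ_ (X ⊗ Y)).hom ≫ 𝟙 (X ⊗ Y) =
    (((ρ_ (𝟙_ W)).inv ⊗ₘ 𝟙 (X ⊗ Y)) ≫ tensorδ (𝟙_ W) X (𝟙_ W) Y) ≫
      ((λ_ X).hom ⊗ₘ (λ_ Y).hom) := by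
  rw [Category.comp_id, tensorHom_id, ← unitors_inv_equal, Category.assoc,
    ← leftUnitor_comp_tensorδ]

theorem rightUnitor_comp_tensorδ' (X Y : W) : (ρ_ (X ⊗ Y)).hom ≫ 𝟙 (X ⊗ Y) =
    ((𝟙 (X ⊗ Y) ⊗ₘ (λ_ (𝟙_ W)).inv) ≫ tensorδ X (𝟙_ W) Y (𝟙_ W)) ≫
      ((ρ_ X).hom ⊗ₘ (ρ_ Y).hom) := by
  rw [Category.comp_id, id_tensorHom, Category.assoc, ← rightUnitor_comp_tensorδ]

end Coherence

/-! ### Strict 2-naturality of the associator and unitors -/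

variable {W : Type u} [Category.{v} W] [MonoidalCategory W] [SymmetricCategory W]
  {P : ObjectProperty W} [P.IsMonoidal] [IsStrictMonoidal P.FullSubcategory]
  {C : Type u₁} [EnrichedCategory W C]

namespace MonoidalVCategory

variable (M : MonoidalVCategory W C)

theorem associator_square {X Y : (SliceTwoCat P C × SliceTwoCat P C) × SliceTwoCat P C}
    (f : X ⟶ Y) :
    (boxData M.tensor).map (Prod.mkHom ((boxData M.tensor).map f.1) f.2) ≫
        (M.liftData (P := P)).associator Y.1.1 Y.1.2 Y.2 =
      (M.liftData (P := P)).associator X.1.1 X.1.2 X.2 ≫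
        (boxData M.tensor).map (Prod.mkHom f.1.1 ((boxData M.tensor).map (Prod.mkHom f.1.2 f.2))) := by
  -- The right unitor removes the parameter `I` of the associator cell composed last, and the
  -- inverse left unitor inserts that of the one composed first.
  refine cell_ext (((IsTransport.rightUnitor ((param f.1.1 ⊗ param f.1.2) ⊗ param f.2)).comp
    (IsTransport.associator (param f.1.1) (param f.1.2) (param f.2))).comp
      (IsTransport.leftUnitor_inv (param f.1.1 ⊗ (param f.1.2 ⊗ param f.2)))) ?_
  refine (congrArg (· ≫ _) (Category.assoc _ _ _)).trans ?_
  refine unitTrans_lift (α_ (param f.1.1).obj (param f.1.2).obj (param f.2).obj).hom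
    ((arrow f.1.1 ⊗ₘ arrow f.1.2) ⊗ₘ arrow f.2) ?_ ?_
    (M.associator.naturality ((X.1.1.to, X.1.2.to), X.2.to) ((Y.1.1.to, Y.1.2.to), Y.2.to))
  · exact tensorHom_comp_tensorHom_comp (arrow f.1.1 ⊗ₘ arrow f.1.2) (arrow f.2) _ _
  · exact associator_tensorHom_comp (arrow f.1.1) (arrow f.1.2) (arrow f.2) _ _

theorem leftUnitor_square {X Y : SliceTwoCat P C} (f : X ⟶ Y) :
    (boxData M.tensor).map (Prod.mkHom (𝟙 (M.liftData (P := P)).unit) f) ≫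
        (M.liftData (P := P)).leftUnitor Y =
      (M.liftData (P := P)).leftUnitor X ≫ f := by
  refine cell_ext (((IsTransport.rightUnitor (𝟙_ _ ⊗ param f)).comp
    (IsTransport.leftUnitor (param f))).comp (IsTransport.leftUnitor_inv (param f))) ?_
  refine (congrArg (· ≫ _) (Category.assoc _ _ _)).trans ?_
  refine unitTrans_lift (λ_ (param f).obj).hom ((λ_ (param f).obj).hom ≫ arrow f) ?_ ?_
    (M.leftUnitor.naturality X.to Y.to)
  · exact insertLeft_lift (arrow f) _ _
  · exact (Category.comp_id _).symm

theorem rightUnitor_square {X Y : SliceTwoCat P C} (f : X ⟶ Y) :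
    (boxData M.tensor).map (Prod.mkHom f (𝟙 (M.liftData (P := P)).unit)) ≫
        (M.liftData (P := P)).rightUnitor Y =
      (M.liftData (P := P)).rightUnitor X ≫ f := by
  refine cell_ext (((IsTransport.rightUnitor (param f ⊗ 𝟙_ _)).comp
    (IsTransport.rightUnitor (param f))).comp (IsTransport.leftUnitor_inv (param f))) ?_
  refine (congrArg (· ≫ _) (Category.assoc _ _ _)).trans ?_
  refine unitTrans_lift (ρ_ (param f).obj).hom ((ρ_ (param f).obj).hom ≫ arrow f) ?_ ?_
    (M.rightUnitor.naturality X.to Y.to)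
  · exact insertRight_lift (arrow f) _ _
  · exact (Category.comp_id _).symm

variable (P) in
/-- The associator as a strict 2-natural transformation. -/
def associatorTrans : Pseudofunctor.StrongTrans
    ((prodPseudofunctor (boxPseudofunctor (P := P) M.tensor) (Pseudofunctor.id _)).comp
      (boxPseudofunctor M.tensor))
    ((prodAssocPseudofunctor (SliceTwoCat P C)).toPseudofunctor.comp
      ((prodPseudofunctor (Pseudofunctor.id _) (boxPseudofunctor M.tensor)).comp
        (boxPseudofunctor M.tensor))) :=
  unitStrongTrans _ _
    (fun X => ForgetEnrichment.homTo W (M.associator.app ((X.1.1.to, X.1.2.to), X.2.to)))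
    (fun f => eqToIso (M.associator_square f))
    (fun f => (α_ (param f.1.1).obj (param f.1.2).obj (param f.2).obj).hom)
    (fun f => reparam_eqToHom (M.associator_square f)
      ((IsTransport.rightUnitor ((param f.1.1 ⊗ param f.1.2) ⊗ param f.2)).comp
        ((IsTransport.associator (param f.1.1) (param f.1.2) (param f.2)).comp
          (IsTransport.leftUnitor_inv (param f.1.1 ⊗ (param f.1.2 ⊗ param f.2))))))
    (fun η => associator_naturality (reparam η.1.1) (reparam η.1.2) (reparam η.2))
    (fun _ => associator_comp_unit)
    (fun f g => associator_comp_tensorδ' (param f.1.1).obj (param f.1.2).obj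
        (param f.2).obj (param g.1.1).obj (param g.1.2).obj (param g.2).obj)

variable (P) in
/-- The left unitor as a strict 2-natural transformation. -/
def leftUnitorTrans : Pseudofunctor.StrongTrans
    ((Bicategory.Prod.sectR (M.liftData (P := P)).unit (SliceTwoCat P C)).toPseudofunctor.comp
      (boxPseudofunctor M.tensor))
    (Pseudofunctor.id (SliceTwoCat P C)) :=
  unitStrongTrans _ _
    (fun X => ForgetEnrichment.homTo W (M.leftUnitor.app X.to))
    (fun f => eqToIso (M.leftUnitor_square f))
    (fun f => (λ_ (param f).obj).hom)
    (fun f => reparam_eqToHom (M.leftUnitor_square f)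
      ((IsTransport.rightUnitor (𝟙_ _ ⊗ param f)).comp
        ((IsTransport.leftUnitor (param f)).comp (IsTransport.leftUnitor_inv (param f)))))
    (fun η => by
      refine Eq.trans ?_ (leftUnitor_naturality (reparam η))
      rw [← id_tensorHom]
      rfl)
    (fun _ => by
      change (λ_ (𝟙_ W)).hom ≫ 𝟙 (𝟙_ W) = (𝟙 (𝟙_ W) ⊗ₘ 𝟙 (𝟙_ W)) ≫ (λ_ (𝟙_ W)).hom
      simp)
    (fun f g => by
      refine (leftUnitor_comp_tensorδ' (param f).obj (param g).obj).trans ?_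
      -- `sectR` compares composites through the right unitor of the identity 1-cell on the unit.
      -- That cell is an `eqToHom`, so its parameter arrow is identified by a lemma instead of by
      -- unfolding.
      refine congrArg (fun x => ((x ⊗ₘ 𝟙 ((param f).obj ⊗ (param g).obj)) ≫
        tensorδ (𝟙_ W) (param f).obj (𝟙_ W) (param g).obj) ≫
          ((λ_ (param f).obj).hom ⊗ₘ (λ_ (param g).obj).hom)) ?_
      exact (reparam_rightUnitor_inv (𝟙 (M.liftData (P := P)).unit)).symm)

variable (P) in
/-- The right unitor as a strict 2-natural transformation. -/
def rightUnitorTrans : Pseudofunctor.StrongTrans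
    ((Bicategory.Prod.sectL (SliceTwoCat P C) (M.liftData (P := P)).unit).toPseudofunctor.comp
      (boxPseudofunctor M.tensor))
    (Pseudofunctor.id (SliceTwoCat P C)) :=
  unitStrongTrans _ _
    (fun X => ForgetEnrichment.homTo W (M.rightUnitor.app X.to))
    (fun f => eqToIso (M.rightUnitor_square f))
    (fun f => (ρ_ (param f).obj).hom)
    (fun f => reparam_eqToHom (M.rightUnitor_square f)
      ((IsTransport.rightUnitor (param f ⊗ 𝟙_ _)).comp
        ((IsTransport.rightUnitor (param f)).comp (IsTransport.leftUnitor_inv (param f)))))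
    (fun η => by
      refine Eq.trans ?_ (rightUnitor_naturality (reparam η))
      rw [← tensorHom_id]
      rfl)
    (fun _ => by
      change (ρ_ (𝟙_ W)).hom ≫ 𝟙 (𝟙_ W) = (𝟙 (𝟙_ W) ⊗ₘ 𝟙 (𝟙_ W)) ≫ (λ_ (𝟙_ W)).hom
      simp [unitors_equal])
    (fun f g => by
      refine (rightUnitor_comp_tensorδ' (param f).obj (param g).obj).trans ?_
      refine congrArg (fun x => ((𝟙 ((param f).obj ⊗ (param g).obj) ⊗ₘ x) ≫
        tensorδ (param f).obj (𝟙_ W) (param g).obj (𝟙_ W)) ≫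
          ((ρ_ (param f).obj).hom ⊗ₘ (ρ_ (param g).obj).hom)) ?_
      exact (reparam_leftUnitor_inv (𝟙 (M.liftData (P := P)).unit)).symm)

/-- The nearly strict monoidal structure, before the pentagon and triangle identities. -/
def liftCore : NearlyStrictMonoidalCore (SliceTwoCat P C) where
  tensor := boxPseudofunctor M.tensor
  unit := (M.liftData (P := P)).unit
  associator := M.associatorTrans P
  leftUnitor := M.leftUnitorTrans P
  rightUnitor := M.rightUnitorTrans P
  -- The naturality cells were defined as `eqToIso` of these squares, so strictness is definitional.
  associator_strict f := ⟨M.associator_square f, rfl⟩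
  leftUnitor_strict f := ⟨M.leftUnitor_square f, rfl⟩
  rightUnitor_strict f := ⟨M.rightUnitor_square f, rfl⟩
  associator_invertible X :=
    have := M.associator_isIso ((X.1.1.to, X.1.2.to), X.2.to)
    liftCell_isInvertible (M.associator.app ((X.1.1.to, X.1.2.to), X.2.to))
  leftUnitor_invertible X :=
    have := M.leftUnitor_isIso X.to
    liftCell_isInvertible (M.leftUnitor.app X.to)
  rightUnitor_invertible X :=
    have := M.rightUnitor_isIso X.to
    liftCell_isInvertible (M.rightUnitor.app X.to)

end MonoidalVCategory

/-- The transport from `I` to `I ⊗ I` is the inverse unitor already present in `tensorHom₀`, so the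
triangle holds by definition. -/
theorem liftCell_tensorHom₀ (T : EnrichedFunctor W (C × C) C) {X₁ Y₁ X₂ Y₂ : C}
    (f₁ : ForgetEnrichment.of W X₁ ⟶ ForgetEnrichment.of W Y₁)
    (f₂ : ForgetEnrichment.of W X₂ ⟶ ForgetEnrichment.of W Y₂) :
    liftCell (P := P) (X := T.obj (X₁, X₂)) (Y := T.obj (Y₁, Y₂)) (tensorHom₀ T f₁ f₂) =
      (boxData T).map (Prod.mkHom (liftCell f₁) (liftCell f₂)) :=
  cell_ext (f := liftCell (X := T.obj (X₁, X₂)) (Y := T.obj (Y₁, Y₂)) (tensorHom₀ T f₁ f₂))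
    (g := (boxData T).map (Prod.mkHom (liftCell f₁) (liftCell f₂)))
    (IsTransport.leftUnitor_inv (𝟙_ P.FullSubcategory)) rfl

theorem liftCell_tensorHom₀_id_right (T : EnrichedFunctor W (C × C) C) {X Y Z : C}
    (f : ForgetEnrichment.of W X ⟶ ForgetEnrichment.of W Y) :
    liftCell (P := P) (X := T.obj (X, Z)) (Y := T.obj (Y, Z)) (tensorHom₀ T f (𝟙 _)) =
      (boxData T).map (Prod.mkHom (liftCell f) (𝟙 (SliceTwoCat.of Z))) := by
  rw [liftCell_tensorHom₀, liftCell_id]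

theorem liftCell_tensorHom₀_id_left (T : EnrichedFunctor W (C × C) C) {X Y Z : C}
    (f : ForgetEnrichment.of W X ⟶ ForgetEnrichment.of W Y) :
    liftCell (P := P) (X := T.obj (Z, X)) (Y := T.obj (Z, Y)) (tensorHom₀ T (𝟙 _) f) =
      (boxData T).map (Prod.mkHom (𝟙 (SliceTwoCat.of Z)) (liftCell f)) := by
  rw [liftCell_tensorHom₀, liftCell_id]

/-! ### Pentagon and triangle transferred from `C₀`; strictness of the inclusion -/

namespace MonoidalVCategory

variable (M : MonoidalVCategory W C)

theorem liftData_pentagon : (M.liftData (P := P)).Pentagon := fun X Y Z T =>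
  (liftCell_comp_eq (liftCell_tensorHom₀_id_right M.tensor _)
    (liftCell_comp_eq rfl (liftCell_tensorHom₀_id_left M.tensor _))).symm.trans
      ((congrArg liftCell (M.pentagon X.to Y.to Z.to T.to)).trans (liftCell_comp_eq rfl rfl))

theorem liftData_triangle : (M.liftData (P := P)).Triangle := fun X Y =>
  (liftCell_comp_eq rfl (liftCell_tensorHom₀_id_left M.tensor _)).symm.trans
    ((congrArg liftCell (M.triangle X.to Y.to)).trans (liftCell_tensorHom₀_id_right M.tensor _))

variable (P) in
/-- The nearly strict monoidal 2-category `U/(-)_* C`. -/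
def lift : NearlyStrictMonoidal (SliceTwoCat P C) where
  toNearlyStrictMonoidalCore := M.liftCore
  pentagon := M.liftData_pentagon
  triangle := M.liftData_triangle

variable (P) in
theorem inclusionStrict : M.InclusionStrict P where
  tensor_obj _ _ := rfl
  unit := rfl
  tensor_map f₁ f₂ := liftCell_tensorHom₀ M.tensor f₁ f₂
  tensorUnitor _ _ := eq_eqToHom _ (IsTransport.leftUnitor_inv (𝟙_ P.FullSubcategory)) rfl
  -- Both parameters are literally `(I ⊗ I) ⊗ (I ⊗ I)`, so the identity serves as transport.
  tensorator _ _ _ _ := eq_eqToHom _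
    (IsTransport.id ((𝟙_ P.FullSubcategory ⊗ 𝟙_ _) ⊗ (𝟙_ _ ⊗ 𝟙_ _))) tensorμ_unit
  associator _ _ _ := rfl
  leftUnitor _ := rfl
  rightUnitor _ := rfl

end MonoidalVCategory

/-! ### The symmetry -/

namespace SymmetricMonoidalVCategory

variable (M : SymmetricMonoidalVCategory W C)

variable (P) in
/-- The naturality 2-cells of the symmetry. -/
def braidingIso {X Y : SliceTwoCat P C × SliceTwoCat P C} (f : X ⟶ Y) :
    (boxData M.tensor).map f ≫ (M.liftData (P := P)).braiding Y.1 Y.2 ≅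
      (M.liftData (P := P)).braiding X.1 X.2 ≫ (boxData M.tensor).map (Prod.mkHom f.2 f.1) :=
  -- Built in the prescribed direction and then inverted, since strong naturality is oriented the
  -- other way; the inverse of the naturality cell is then definitionally the prescribed one.
  (cellIso (f := (M.liftData (P := P)).braiding X.1 X.2 ≫
      (boxData M.tensor).map (Prod.mkHom f.2 f.1))
    (g := (boxData M.tensor).map f ≫ (M.liftData (P := P)).braiding Y.1 Y.2)
    (λ_ ((param f.2).obj ⊗ (param f.1).obj) ≪≫ β_ (param f.2).obj (param f.1).obj ≪≫
      (ρ_ ((param f.1).obj ⊗ (param f.2).obj)).symm)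
    (braiding_lift _ _ _ _ _ _ _ _
      (M.braiding.naturality (X.1.to, X.2.to) (Y.1.to, Y.2.to)))).symm

/-- The inverse of a symmetry is again a symmetry, which puts the cell in the form required by
`unitStrongTrans`. -/
theorem reparam_braidingIso_hom {X Y : SliceTwoCat P C × SliceTwoCat P C} (f : X ⟶ Y) :
    reparam (M.braidingIso P f).hom = (ρ_ ((param f.1).obj ⊗ (param f.2).obj)).hom ≫
      (β_ (param f.1).obj (param f.2).obj).hom ≫
        (λ_ ((param f.2).obj ⊗ (param f.1).obj)).inv := by
  rw [SymmetricCategory.braiding_swap_eq_inv_braiding (param f.2).obj (param f.1).obj]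
  exact Category.assoc _ _ _

variable (P) in
/-- The symmetry as a strong transformation. -/
def braidingTrans : Pseudofunctor.StrongTrans (boxPseudofunctor (P := P) M.tensor)
    ((Bicategory.Prod.swap (SliceTwoCat P C) (SliceTwoCat P C)).toPseudofunctor.comp
      (boxPseudofunctor M.tensor)) :=
  unitStrongTrans _ _
    (fun X => ForgetEnrichment.homTo W (M.braiding.app (X.1.to, X.2.to)))
    (fun f => M.braidingIso P f)
    (fun f => (β_ (param f.1).obj (param f.2).obj).hom)
    (fun f => M.reparam_braidingIso_hom f)
    (fun η => BraidedCategory.braiding_naturality (reparam η.1) (reparam η.2))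
    (fun _ => by
      change (β_ (𝟙_ W) (𝟙_ W)).hom ≫ (𝟙 (𝟙_ W) ⊗ₘ 𝟙 (𝟙_ W)) ≫ (λ_ (𝟙_ W)).hom =
        (λ_ (𝟙_ W)).hom
      rw [id_tensorHom_id, Category.id_comp, CategoryTheory.braiding_leftUnitor, unitors_equal])
    (fun f g => by
      refine Eq.trans ?_ (braiding_comp_tensorδ (param f.1).obj (param f.2).obj
        (param g.1).obj (param g.2).obj)
      refine congrArg ((β_ ((param f.1).obj ⊗ (param g.1).obj)
        ((param f.2).obj ⊗ (param g.2).obj)).hom ≫ ·) ?_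
      -- The tensored identities come from the composition comparison of the swap 2-functor.
      change (𝟙 ((param f.2).obj ⊗ (param g.2).obj) ⊗ₘ 𝟙 ((param f.1).obj ⊗ (param g.1).obj)) ≫
        tensorδ (param f.2).obj (param f.1).obj (param g.2).obj (param g.1).obj = _
      rw [id_tensorHom_id, Category.id_comp])

variable (P) in
/-- The nearly strict symmetric monoidal structure, before the symmetry axioms. -/
def liftCore : NearlyStrictSymmetricMonoidalCore (SliceTwoCat P C) where
  toNearlyStrictMonoidal := M.toMonoidalVCategory.lift P
  braiding := M.braidingTrans P

theorem liftData_involutive : (M.liftData (P := P)).Involutive := fun X Y =>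
  (liftCell_comp_eq rfl rfl).symm.trans
    ((congrArg liftCell (M.braiding_braiding X.to Y.to)).trans (liftCell_id _))

theorem liftData_hexagon : (M.liftData (P := P)).Hexagon := fun X Y Z =>
  (liftCell_comp_eq rfl (liftCell_comp_eq rfl rfl)).symm.trans
    ((congrArg liftCell (M.hexagon X.to Y.to Z.to)).trans
      (liftCell_comp_eq (liftCell_tensorHom₀_id_right M.tensor _)
        (liftCell_comp_eq rfl (liftCell_tensorHom₀_id_left M.tensor _))))

theorem liftData_unitTriangle : (M.liftData (P := P)).UnitTriangle := fun X =>
  (liftCell_comp_eq rfl rfl).symm.trans (congrArg liftCell (M.braiding_leftUnitor X.to))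

variable (P) in
/-- The nearly strict symmetric monoidal 2-category `U/(-)_* C`. -/
def lift : NearlyStrictSymmetricMonoidal (SliceTwoCat P C) where
  toNearlyStrictSymmetricMonoidalCore := M.liftCore P
  involutive := M.liftData_involutive
  hexagon := M.liftData_hexagon
  unitTriangle := M.liftData_unitTriangle

variable (P) in
theorem inclusionStrict : M.InclusionStrict P where
  toInclusionStrict := M.toMonoidalVCategory.inclusionStrict P
  braiding _ _ := rfl
  braidingCell _ _ := eq_eqToHom _
    ((IsTransport.leftUnitor (𝟙_ P.FullSubcategory ⊗ 𝟙_ _)).comp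
      (IsTransport.rightUnitor_inv (𝟙_ P.FullSubcategory ⊗ 𝟙_ _)))
    (by
      change (λ_ (𝟙_ W ⊗ 𝟙_ W)).hom ≫ (β_ (𝟙_ W) (𝟙_ W)).hom ≫ (ρ_ (𝟙_ W ⊗ 𝟙_ W)).inv =
        (λ_ (𝟙_ W ⊗ 𝟙_ W)).hom ≫ (ρ_ (𝟙_ W ⊗ 𝟙_ W)).inv
      rw [braiding_tensorUnit_left]
      monoidal)

end SymmetricMonoidalVCategory

end PartialSlice

theorem proposition3p11 {W : Type u} [Category.{v} W] [MonoidalCategory W] [SymmetricCategory W]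
    (P : ObjectProperty W) [P.IsMonoidal] [IsStrictMonoidal P.FullSubcategory]
    {C : Type u₁} [EnrichedCategory W C] :
    (∃ ι : StrictPseudofunctor (LocallyDiscrete (ForgetEnrichment W C)) (SliceTwoCat P C),
      ι.toPrelaxFunctorStruct = inclusionData P C) ∧
    (∀ 𝓜 : MonoidalVCategory W C,
      (∃ M : NearlyStrictMonoidal (SliceTwoCat P C), M.data = 𝓜.liftData) ∧
      𝓜.InclusionStrict P) ∧
    (∀ 𝓢 : SymmetricMonoidalVCategory W C,
      (∃ M : NearlyStrictSymmetricMonoidal (SliceTwoCat P C), M.symmetricData = 𝓢.liftData) ∧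
      𝓢.InclusionStrict P) :=
  -- Each `rfl` checks that the structure constructed has exactly the prescribed data.
  ⟨⟨inclusion P C, rfl⟩,
    fun 𝓜 => ⟨⟨𝓜.lift P, rfl⟩, 𝓜.inclusionStrict P⟩,
    fun 𝓢 => ⟨⟨𝓢.lift P, rfl⟩, 𝓢.inclusionStrict P⟩⟩
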